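/- Let $k$ be an algebraically closed field of characteristic $p\ge 0$. For a finite-dimensional $k$-vector space $V$ and a finite subgroup $G\le GL(V)$, let $S(V^*)$ be the symmetric algebra of the dual space (the coordinate ring of $V$), on which $G$ acts by $(g\cdot f)(v)=f(g^{-1}v)$, and let $V/G=\operatorname{Spec} S(V^*)^G$. An element of $GL(V)$ is a pseudoreflection if it has finite order and its set of fixed points is a hyperplane of $V$. For a subspace $W\subseteq V$ let $\operatorname{Fix}_G(W)$ be the pointwise stabilizer of $W$ in $G$. A ring of invariants is called polynomial if it is isomorphic, as a $k$-algebra, to a polynomial ring in finitely many variables. We say that $V/G$ is an isolated singularity if the local ring of $V/G$ at the image $Q$ of $0\in V$ is not regular and some Zariski open neighbourhood of $Q$ in $V/G$ contains no other singular (closed) point. Then the following two statements are equivalent: (1) For every finite-dimensional $k$-vector space $V$ and every finite subgroup $G\le GL(V)$ (irreducible or not), the ring $S(V^*)^G$ is polynomial if and only if $G$ is generated by pseudoreflections and $S(V^*)^{\operatorname{Fix}_G(W)}$ is polynomial for every nonzero subspace $W\subseteq V$. (2) For every finite-dimensional $k$-vector space $V$ and every finite subgroup $G\le GL(V)$ such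 that $V/G$ is an isolated singularity, if $H$ denotes the normal subgroup of $G$ generated by the pseudoreflections in $G$, then $V/H$ is nonsingular, $p\nmid |G/H|$ (an empty condition for $p=0$), and there is a natural isomorphism $V/G\simeq (V/H)/(G/H)$, that is, one compatible with the projections $V\to V/G$ and $V\to V/H\to (V/H)/(G/H)$, where $G/H$ acts on $V/H$ by the action induced from $G$. -/

import Mathlib

open AlgebraicGeometry CategoryTheory

universe u v

noncomputable section

namespace QuotientSingularity

section GeneralNotions

/-- A commutative `k`-algebra is a polynomial ring if it is isomorphic, as a `k`-algebra, to a
polynomial ring in finitely many variables over `k`. -/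
def IsPolynomialRing (k : Type*) [CommRing k] (A : Type*) [CommRing A] [Algebra k A] : Prop :=
  ∃ n : ℕ, Nonempty (A ≃ₐ[k] MvPolynomial (Fin n) k)

/-- A point of a scheme is regular if its local ring is a regular local ring. -/
def IsRegularPoint (X : Scheme.{u}) (x : X) : Prop :=
  IsRegularLocalRing (X.presheaf.stalk x)

/-- A scheme is nonsingular if all its points are regular. -/
def IsNonsingular (X : Scheme.{u}) : Prop :=
  ∀ x : X, IsRegularPoint X x

/-- `Q` is an isolated singularity of the variety `X`: the local ring at `Q` is not regular, and
some Zariski open neighbourhood of `Q` has no other singular point. As is usual for varieties,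
the points meant here are the closed ones. -/
def IsIsolatedSingularity (X : Scheme.{u}) (Q : X) : Prop :=
  ¬ IsRegularPoint X Q ∧
    ∃ U : X.Opens, Q ∈ U ∧ ∀ x ∈ U, IsClosed {x} → x ≠ Q → IsRegularPoint X x

/-- The quotient `(Spec A)/Γ = Spec (A^Γ)` of the affine scheme `Spec A` by a group `Γ` acting
on `A` by `k`-algebra automorphisms. -/
def affineQuotient (k : Type*) [CommRing k] (Γ : Type*) [Group Γ] (A : Type u) [CommRing A]
    [Algebra k A] [MulSemiringAction Γ A] [SMulCommClass Γ k A] : Scheme.{u} :=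
  Spec (CommRingCat.of (FixedPoints.subalgebra k A Γ))

/-- The natural projection `Spec A ⟶ (Spec A)/Γ`. -/
def affineQuotientMap (k : Type*) [CommRing k] (Γ : Type*) [Group Γ] (A : Type u) [CommRing A]
    [Algebra k A] [MulSemiringAction Γ A] [SMulCommClass Γ k A] :
    Spec (CommRingCat.of A) ⟶ affineQuotient k Γ A :=
  Spec.map (CommRingCat.ofHom (FixedPoints.subalgebra k A Γ).val.toRingHom)

end GeneralNotions

section LinearGroups

variable (k : Type u) [Field k] (V : Type v) [AddCommGroup V] [Module k V]

/-- The coordinate ring `S(V*)` of `V`. -/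
abbrev CoordRing : Type (max u v) := SymmetricAlgebra k (Module.Dual k V)

variable {k V}

/-- The endomorphism of `S(V*)` induced by `g ∈ GL(V)`; on linear forms it is `ℓ ↦ ℓ ∘ g⁻¹`. -/
def coordAct (g : V ≃ₗ[k] V) : CoordRing k V →ₐ[k] CoordRing k V :=
  SymmetricAlgebra.lift
    (SymmetricAlgebra.ι k (Module.Dual k V) ∘ₗ ((g⁻¹ : V ≃ₗ[k] V) : V →ₗ[k] V).dualMap)

theorem coordAct_ι (g : V ≃ₗ[k] V) (l : Module.Dual k V) :
    coordAct g (SymmetricAlgebra.ι k (Module.Dual k V) l) =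
      SymmetricAlgebra.ι k (Module.Dual k V) (l ∘ₗ ((g⁻¹ : V ≃ₗ[k] V) : V →ₗ[k] V)) := by
  simp [coordAct, LinearMap.dualMap_apply']

theorem coordAct_one : coordAct (1 : V ≃ₗ[k] V) = AlgHom.id k (CoordRing k V) := by
  apply SymmetricAlgebra.algHom_ext
  ext l
  change coordAct 1 (SymmetricAlgebra.ι k (Module.Dual k V) l) =
    SymmetricAlgebra.ι k (Module.Dual k V) l
  rw [coordAct_ι]
  rfl

theorem coordAct_mul (g h : V ≃ₗ[k] V) :
    coordAct (g * h) = (coordAct g).comp (coordAct h) := by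
  apply SymmetricAlgebra.algHom_ext
  ext l
  change coordAct (g * h) (SymmetricAlgebra.ι k (Module.Dual k V) l) =
    coordAct g (coordAct h (SymmetricAlgebra.ι k (Module.Dual k V) l))
  rw [coordAct_ι, coordAct_ι, coordAct_ι, mul_inv_rev]
  rfl

/-- The action of `GL(V)` on `S(V*)` by `k`-algebra automorphisms; subgroups of `GL(V)`, and
their subgroups, act by restriction. -/
instance : MulSemiringAction (V ≃ₗ[k] V) (CoordRing k V) where
  smul g f := coordAct g f
  one_smul f := by
    change coordAct 1 f = f
    rw [coordAct_one]; rfl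
  mul_smul g h f := by
    change coordAct (g * h) f = coordAct g (coordAct h f)
    rw [coordAct_mul]; rfl
  smul_zero g := map_zero (coordAct g)
  smul_add g := map_add (coordAct g)
  smul_one g := map_one (coordAct g)
  smul_mul g := map_mul (coordAct g)

instance : SMulCommClass (V ≃ₗ[k] V) k (CoordRing k V) where
  smul_comm g c f := map_smul (coordAct g) c f

/-- A pseudoreflection: a linear automorphism of finite order whose set of fixed points is a
hyperplane. -/
def IsPseudoreflection (g : V ≃ₗ[k] V) : Prop :=
  IsOfFinOrder g ∧ IsCoatom (g : V →ₗ[k] V).fixedSubmodule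

/-- The subgroup of `G` generated by the pseudoreflections contained in `G`. -/
def pseudoreflectionSubgroup (G : Subgroup (V ≃ₗ[k] V)) : Subgroup G :=
  Subgroup.closure {g : G | IsPseudoreflection (g : V ≃ₗ[k] V)}

theorem IsPseudoreflection.conj {g : V ≃ₗ[k] V} (hg : IsPseudoreflection g) (h : V ≃ₗ[k] V) :
    IsPseudoreflection (h * g * h⁻¹) := by
  refine ⟨(MulAut.conj h).toMonoidHom.isOfFinOrder hg.1, ?_⟩
  have key : ((h * g * h⁻¹ : V ≃ₗ[k] V) : V →ₗ[k] V).fixedSubmodule =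
      Submodule.orderIsoMapComap h (g : V →ₗ[k] V).fixedSubmodule := by
    ext x
    simp only [Submodule.orderIsoMapComap_apply, LinearMap.mem_fixedSubmodule_iff]
    constructor
    · intro hx
      refine ⟨h⁻¹ x, ?_, LinearEquiv.apply_symm_apply h x⟩
      change g (h.symm x) = h.symm x
      rw [LinearEquiv.eq_symm_apply]
      exact hx
    · rintro ⟨y, hy, rfl⟩
      change h (g (h.symm (h y))) = h y
      rw [LinearEquiv.symm_apply_apply]
      exact congrArg h hy
  rw [key, OrderIso.isCoatom_iff]
  exact hg.2

instance (G : Subgroup (V ≃ₗ[k] V)) : (pseudoreflectionSubgroup G).Normal := by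
  refine ⟨fun n hn g => ?_⟩
  have hle : pseudoreflectionSubgroup G ≤
      (pseudoreflectionSubgroup G).comap (MulAut.conj g).toMonoidHom := by
    refine (Subgroup.closure_le _).2 fun x hx => ?_
    exact Subgroup.subset_closure (IsPseudoreflection.conj hx (g : V ≃ₗ[k] V))
  exact hle hn

variable (k V) in
/-- The origin of `V = Spec S(V*)`: the ideal of polynomial functions without constant term. -/
def origin : Spec (CommRingCat.of (CoordRing k V)) :=
  ⟨RingHom.ker (SymmetricAlgebra.algebraMapInv (R := k) (M := Module.Dual k V)),
    RingHom.ker_isPrime _⟩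

/-- The ring of invariants `S(V*)^Γ`, for a group `Γ` acting on `V` linearly
(a subgroup of `GL(V)`, or a subgroup of such a subgroup). -/
abbrev Invariants (k : Type u) [Field k] (V : Type v) [AddCommGroup V] [Module k V] (Γ : Type*)
    [Group Γ] [MulSemiringAction Γ (CoordRing k V)] [SMulCommClass Γ k (CoordRing k V)] :
    Subalgebra k (CoordRing k V) :=
  FixedPoints.subalgebra k (CoordRing k V) Γ

/-- The quotient variety `V/Γ = Spec S(V*)^Γ`. -/
abbrev quotientVariety (k : Type u) [Field k] (V : Type v) [AddCommGroup V] [Module k V]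
    (Γ : Type*) [Group Γ] [MulSemiringAction Γ (CoordRing k V)]
    [SMulCommClass Γ k (CoordRing k V)] : Scheme.{max u v} :=
  affineQuotient k Γ (CoordRing k V)

/-- The natural projection `V ⟶ V/Γ`. -/
abbrev quotientProj (k : Type u) [Field k] (V : Type v) [AddCommGroup V] [Module k V]
    (Γ : Type*) [Group Γ] [MulSemiringAction Γ (CoordRing k V)]
    [SMulCommClass Γ k (CoordRing k V)] :
    Spec (CommRingCat.of (CoordRing k V)) ⟶ quotientVariety k V Γ :=
  affineQuotientMap k Γ (CoordRing k V)

/-- `V/G` is an isolated singularity (at the image of the fixed point `0 ∈ V`). -/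
def IsIsolatedQuotientSingularity (G : Subgroup (V ≃ₗ[k] V)) : Prop :=
  IsIsolatedSingularity (quotientVariety k V G) (quotientProj k V G (origin k V))

/-- For a normal subgroup `H` of `G`, the quotient `(V/H)/(G/H)` of the variety `V/H` by the
induced action of `G/H`, which on `S(V*)^H` is `(gH) • f = g • f`. -/
abbrev iteratedQuotient (G : Subgroup (V ≃ₗ[k] V)) (H : Subgroup G) [H.Normal] :
    Scheme.{max u v} :=
  affineQuotient k (G ⧸ H) (Invariants k V H)

/-- The natural projection `V/H ⟶ (V/H)/(G/H)`. -/
abbrev iteratedQuotientProj (G : Subgroup (V ≃ₗ[k] V)) (H : Subgroup G) [H.Normal] :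
    quotientVariety k V H ⟶ iteratedQuotient G H :=
  affineQuotientMap k (G ⧸ H) (Invariants k V H)

end LinearGroups

end QuotientSingularity

end

/-! The bridge between the two statements is a local comparison at a vector `w`. Near the image of
`w`, the quotient by `G` looks like the quotient by the stabilizer of `w`: the cotangent spaces
agree (`finrank_cotangent_stabilizer_eq`). Translation by `w` moves this point to the origin
(`finrank_cotangent_translate`), and there a graded ring of invariants whose cotangent space has
dimension `dim V` is polynomial (`isPolynomialRing_of_finrank_cotangent`). Every nonzero `W`
contains a nonzero `w`, arbitrarily generic, whose stabilizer is the pointwise stabilizer of `W`.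
Hence `V/G` is regular away from the origin exactly when all pointwise stabilizers of nonzero
subspaces have polynomial invariants.

(1) implies (2). Let `H` be generated by the pseudoreflections of `G`. The groups `Fix_G(W)` have
polynomial invariants, so by Serre's theorem (`pseudoreflectionSubgroup_eq_top`) they are generated
by pseudoreflections and lie in `H`. So `Fix_H(W) = Fix_G(W)`, and (1) applied to `H` makes `V/H` an
affine space. If `p` divided `|G/H|`, an element of order `p` would act on the polynomial ring `S^H`
with the origin as its only fixed point on `V/H`. Being unipotent on the invariants of least
positive degree, it fixes one of the homogeneous generators, so its fixed locus is cut out by `dim V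
- 1` equations, against Krull's height theorem (`not_dvd_card_quotient`). The isomorphism in stages
is formal.

(2) implies (1). Polynomiality passes to generation by pseudoreflections and to stabilizers by the
results above. Conversely, a group satisfying the right side of (1) without polynomial invariants
would give an isolated singularity with `H = G`, and then (2) would make `V/G` nonsingular.

Serre's theorem is proved without completions of `S`. If `S^G = k[f_1, ..., f_n]`, the map `f_i ↦
f_i + t_i` extends, by Hensel's lemma, from `S^G` to `S^H` with values in power series over `Frac
S`. Here `H` is normal and contains all inertia groups of principal primes. Unramifiedness at each
such prime puts the coefficients in `S`. Evaluating them at the origin, a fixed point, gives an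
injective map from `S^H` to `k[[t]]` that does not change under `G`, so `G` acts trivially on `S^H`.
-/

noncomputable section

namespace QuotientSingularity

/-! ### Extension of ring homomorphisms, simple roots, power series -/

section RingExtension

/-- A ring homomorphism extends along a subring containing a multiple of every element by a
fixed element that becomes invertible. -/
theorem exists_ringHom_of_smul_mem_range {C B S Λ : Type*} [CommRing C] [CommRing B] [CommRing S]
    [CommRing Λ] (π : C →+* S) (ι : B →+* S) (ψ : C →+* Λ) (hker : ∀ p, π p = 0 → ψ p = 0) (d : C)
    (hd : IsUnit (ψ d)) (h : ∀ b, ∃ p, π p = π d * ι b) :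
    ∃ E : B →+* Λ, ∀ b p, π p = π d * ι b → E b * ψ d = ψ p := by
  have heq : ∀ p q, π p = π q → ψ p = ψ q := fun p q hpq => by
    rw [← sub_eq_zero, ← map_sub]
    exact hker _ (by rw [map_sub, hpq, sub_self])
  choose f hf using h
  obtain ⟨u, hu⟩ := hd
  have key : ∀ b p, π p = π d * ι b → ψ (f b) * ↑u⁻¹ * ψ d = ψ p := fun b p hp => by
    rw [← hu, Units.inv_mul_cancel_right]
    exact heq _ _ ((hf b).trans hp.symm)
  have cancel : ∀ x y : Λ, x * ψ d = y * ψ d → x = y := fun x y hxy => by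
    rw [← hu] at hxy
    exact (Units.mul_left_inj u).1 hxy
  refine ⟨{ toFun := fun b => ψ (f b) * ↑u⁻¹, map_one' := ?_, map_mul' := ?_, map_zero' := ?_,
            map_add' := ?_ }, fun b p hp => key b p hp⟩
  · apply cancel
    rw [key 1 d (by simp), one_mul]
  · intro x y
    -- The product `f x * f y` carries the factor `d` twice, so the unit has to be cancelled twice.
    apply cancel
    apply cancel
    rw [mul_assoc _ _ (ψ d), ← map_mul ψ d d]
    have h1 : ψ (f (x * y)) * ↑u⁻¹ * ψ (d * d) = ψ (f x * f y) := by
      rw [map_mul ψ d, ← mul_assoc, key (x * y) _ (hf _), ← map_mul]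
      apply heq
      rw [map_mul, map_mul, hf, hf, hf, map_mul]
      ring
    have h2 : (↑u⁻¹ * ↑u : Λ) = 1 := u.inv_mul
    rw [h1, map_mul, ← hu]
    linear_combination (-ψ (f x) * ψ (f y) * (1 + (↑u⁻¹ * ↑u : Λ))) * h2
  · apply cancel
    rw [key 0 0 (by simp), zero_mul, map_zero]
  · intro x y
    apply cancel
    rw [key (x + y) (f x + f y) (by rw [map_add, hf, hf, map_add]; ring), add_mul, map_add,
      key x _ (hf x), key y _ (hf y)]

/-- Two congruent roots of a polynomial coincide if they are simple. -/
theorem eq_of_eval_eq_zero_of_isUnit {Λ : Type*} [CommRing Λ] (P : _root_.Polynomial Λ) {x y : Λ}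
    (hx : P.eval x = 0) (hy : P.eval y = 0)
    (hu : ∀ c, IsUnit (P.derivative.eval x + c * (y - x))) : x = y := by
  obtain ⟨c, hc⟩ := P.binomExpansion x (y - x)
  rw [add_sub_cancel, hx, hy, zero_add] at hc
  have h0 : (P.derivative.eval x + c * (y - x)) * (y - x) = 0 := by rw [hc]; ring
  rw [(hu c).mul_right_eq_zero, sub_eq_zero] at h0
  exact h0.symm

/-- Choose for each nonzero exponent one variable occurring in it, and collect the monomials
assigned to the same variable. This gives one inclusion between the ideal of the variables, for
which power series are Henselian, and the kernel of the constant coefficient. -/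
theorem mem_span_range_X_of_constantCoeff_eq_zero {σ A : Type*} [Finite σ]
    [CommRing A] {f : MvPowerSeries σ A} (hf : MvPowerSeries.constantCoeff f = 0) :
    f ∈ Ideal.span (Set.range (MvPowerSeries.X : σ → MvPowerSeries σ A)) := by
  classical
  have := Fintype.ofFinite σ
  have hex : ∀ e : σ →₀ ℕ, e ≠ 0 → ∃ i, e i ≠ 0 := fun e he => by
    by_contra! h
    exact he (Finsupp.ext h)
  choose i hi using hex
  let g : σ → MvPowerSeries σ A := fun j m =>
    if ∃ h, i (Finsupp.single j 1 + m) h = j then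
      MvPowerSeries.coeff (Finsupp.single j 1 + m) f else 0
  have hg : f = ∑ j, MvPowerSeries.X j * g j := by
    ext e
    rw [map_sum]
    by_cases he : e = 0
    · subst he
      rw [MvPowerSeries.coeff_zero_eq_constantCoeff_apply, hf, Finset.sum_eq_zero]
      intro j _
      simp
    · have hle : ∀ j, e j ≠ 0 → Finsupp.single j 1 + (e - Finsupp.single j 1) = e := fun j hj =>
        add_tsub_cancel_of_le (Finsupp.single_le_iff.2 (Nat.one_le_iff_ne_zero.2 hj))
      have hc : ∀ j, MvPowerSeries.coeff e (MvPowerSeries.X j * g j) =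
          if i e he = j then MvPowerSeries.coeff e f else 0 := fun j => by
        rw [MvPowerSeries.X, MvPowerSeries.coeff_monomial_mul]
        by_cases hj : e j = 0
        · rw [if_neg, if_neg]
          · rintro rfl
            exact hi e he hj
          · rw [Finsupp.single_le_iff, hj]
            simp
        · rw [if_pos (Finsupp.single_le_iff.2 (Nat.one_le_iff_ne_zero.2 hj)), one_mul]
          change (if ∃ h, i (Finsupp.single j 1 + (e - Finsupp.single j 1)) h = j then
            MvPowerSeries.coeff (Finsupp.single j 1 + (e - Finsupp.single j 1)) f else 0) = _
          simp only [hle j hj]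
          simp [he]
      simp [hc]
  rw [hg]
  exact Ideal.sum_mem _ fun j _ => Ideal.mul_mem_right _ _ (Ideal.subset_span ⟨j, rfl⟩)

end RingExtension

/-! ### Relative traces and orbit polynomials -/

section GroupActions

variable {G : Type*} [Group G] [Finite G]

/-- The relative trace from `Γ` to `G`: the sum over representatives of the cosets `gΓ`. -/
def relTrace {M : Type*} [AddCommMonoid M] [DistribMulAction G M] (Γ : Subgroup G) (m : M) : M :=
  letI := Fintype.ofFinite (G ⧸ Γ)
  ∑ c : G ⧸ Γ, c.out • m

theorem smul_relTrace {M : Type*} [AddCommMonoid M] [DistribMulAction G M] (Γ : Subgroup G)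
    {m : M} (hm : ∀ h ∈ Γ, h • m = m) (g : G) : g • relTrace Γ m = relTrace Γ m := by
  let := Fintype.ofFinite (G ⧸ Γ)
  rw [relTrace, Finset.smul_sum]
  refine Fintype.sum_equiv (MulAction.toPerm g) _ _ fun c => ?_
  have h1 : (((g • c).out : G) : G ⧸ Γ) = ((g * c.out : G) : G ⧸ Γ) := by
    rw [QuotientGroup.out_eq', ← smul_eq_mul, MulAction.Quotient.coe_smul_out]
  rw [MulAction.toPerm_apply, smul_smul]
  have h2 := hm _ (QuotientGroup.eq.1 h1)
  conv_rhs => rw [← h2]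
  rw [smul_smul, mul_inv_cancel_left]

/-- Only the trivial coset contributes. This localizes a trace at one point of an orbit. -/
theorem relTrace_eq_of_forall_notMem {M N : Type*} [AddCommMonoid M] [DistribMulAction G M]
    [AddCommMonoid N] (Γ : Subgroup G) {m : M} (hm : ∀ h ∈ Γ, h • m = m) (f : M →+ N)
    (hf : ∀ g ∉ Γ, f (g • m) = 0) : f (relTrace Γ m) = f m := by
  let := Fintype.ofFinite (G ⧸ Γ)
  rw [relTrace, map_sum, Fintype.sum_eq_single ((1 : G) : G ⧸ Γ)]
  · congr 1
    apply hm
    have : (((((1 : G) : G ⧸ Γ)).out : G) : G ⧸ Γ) = ((1 : G) : G ⧸ Γ) := QuotientGroup.out_eq' _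
    rw [eq_comm, QuotientGroup.eq] at this
    simpa using this
  · intro c hc
    apply hf
    intro hmem
    apply hc
    rw [← QuotientGroup.out_eq' c, eq_comm, QuotientGroup.eq]
    simpa using hmem

theorem relTrace_mul_left {S : Type*} [CommRing S] [MulSemiringAction G S] (Γ : Subgroup G)
    {r : S} (hr : ∀ g : G, g • r = r) (s : S) : relTrace Γ (r * s) = r * relTrace Γ s := by
  let := Fintype.ofFinite (G ⧸ Γ)
  simp only [relTrace, smul_mul', hr, Finset.mul_sum]

open _root_.Polynomial in
/-- The product of the `X - c` for the conjugates `c ≠ y` of `y`. -/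
def orbitCofactor (G : Type*) [Group G] [Finite G] {S : Type*} [CommRing S]
    [MulSemiringAction G S] (y : S) : S[X] :=
  haveI := Classical.decEq S
  ∏ c ∈ (Set.finite_range fun g : G => g • y).toFinset.erase y, (X - C c)

section

open _root_.Polynomial

variable {S : Type*} [CommRing S] [MulSemiringAction G S]

theorem mem_range_smul {G S : Type*} [Group G] [MulAction G S] {y c : S} (g : G)
    (hc : c ∈ Set.range fun h : G => h • y) :
    g • c ∈ Set.range fun h : G => h • y :=
  MulAction.mem_orbit_of_mem_orbit g hc

theorem monic_orbitCofactor (y : S) : (orbitCofactor G y).Monic :=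
  monic_prod_of_monic _ _ fun _ _ => monic_X_sub_C _

theorem smul_orbitCofactor (y : S) {g : G} (hg : g • y = y) :
    g • orbitCofactor G y = orbitCofactor G y := by
  classical
  simp only [orbitCofactor]
  rw [Finset.smul_prod']
  refine Finset.prod_bij (fun c _ => g • c) ?_ ?_ ?_ ?_
  · intro c hc
    rw [Finset.mem_erase, Set.Finite.mem_toFinset] at hc ⊢
    refine ⟨fun h => hc.1 ?_, (mem_range_smul g hc.2)⟩
    rw [← hg] at h
    exact smul_left_cancel _ h
  · intro a _ b _ h
    exact smul_left_cancel _ h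
  · intro c hc
    rw [Finset.mem_erase, Set.Finite.mem_toFinset] at hc
    refine ⟨g⁻¹ • c, ?_, smul_inv_smul _ _⟩
    rw [Finset.mem_erase, Set.Finite.mem_toFinset]
    refine ⟨fun h => hc.1 ?_, (mem_range_smul _ hc.2)⟩
    rw [inv_smul_eq_iff, hg] at h
    exact h
  · intro c _
    rw [smul_sub, smul_X, smul_C]

theorem X_sub_C_mul_orbitCofactor [DecidableEq S] (y : S) :
    (X - C y) * orbitCofactor G y =
      ∏ c ∈ (Set.finite_range fun g : G => g • y).toFinset, (X - C c) := by
  rw [orbitCofactor]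
  convert Finset.mul_prod_erase _ (fun c => X - C c) _
  rw [Set.Finite.mem_toFinset]
  exact ⟨1, one_smul G y⟩

theorem smul_X_sub_C_mul_orbitCofactor (y : S) (g : G) :
    g • ((X - C y) * orbitCofactor G y) = (X - C y) * orbitCofactor G y := by
  classical
  rw [X_sub_C_mul_orbitCofactor, Finset.smul_prod']
  refine Finset.prod_bij (fun c _ => g • c) ?_ ?_ ?_ ?_
  · intro c hc
    rw [Set.Finite.mem_toFinset] at hc ⊢
    exact mem_range_smul g hc
  · intro a _ b _ h
    exact smul_left_cancel _ h
  · intro c hc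
    rw [Set.Finite.mem_toFinset] at hc
    refine ⟨g⁻¹ • c, ?_, smul_inv_smul _ _⟩
    rw [Set.Finite.mem_toFinset]
    exact mem_range_smul _ hc
  · intro c _
    rw [smul_sub, smul_X, smul_C]

/-- At `x = y` the value is the derivative of the orbit polynomial at its root `y`, so this is the
simple root condition modulo `𝔮`; at `x = 0` it is the product of the other conjugates up to sign.
-/
theorem eval_orbitCofactor_notMem {𝔮 : Ideal S} [𝔮.IsPrime] (x y : S)
    (h : ∀ g : G, g • y ≠ y → x - g • y ∉ 𝔮) : (orbitCofactor G y).eval x ∉ 𝔮 := by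
  classical
  rw [orbitCofactor, eval_prod]
  intro hmem
  obtain ⟨c, hc, hc'⟩ := (Ideal.IsPrime.prod_mem_iff).1 hmem
  rw [Finset.mem_erase, Set.Finite.mem_toFinset] at hc
  obtain ⟨hne, g, rfl⟩ := hc
  exact h g hne (by simpa using hc')

theorem eval_orbitCofactor_smul (y : S) {g : G} (h : g • y ≠ y) :
    (orbitCofactor G y).eval (g • y) = 0 := by
  classical
  rw [orbitCofactor, eval_prod]
  refine Finset.prod_eq_zero (i := g • y) ?_ (by simp)
  rw [Finset.mem_erase, Set.Finite.mem_toFinset]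
  exact ⟨h, g, rfl⟩

end

end GroupActions

/-! ### Lifting homomorphisms into power series along unramified extensions -/

section Taylor

open _root_.Polynomial

variable {k S G : Type*} [Field k] [CommRing S] [Algebra k S] [Group G]
  [MulSemiringAction G S] [SMulCommClass G k S]

theorem exists_map_algebraMap_eq {P : S[X]} (hP : ∀ g : G, g • P = P) :
    ∃ P₀ : (FixedPoints.subalgebra k S G)[X], P₀.map (algebraMap _ S) = P := by
  rw [← Polynomial.mem_lifts, Polynomial.lifts_iff_coeff_lifts]
  intro n
  refine ⟨⟨P.coeff n, fun g => ?_⟩, rfl⟩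
  rw [← Polynomial.coeff_smul, hP]

theorem exists_monic_map_algebraMap_eq {P : S[X]} (hm : P.Monic) (hP : ∀ g : G, g • P = P) :
    ∃ P₀ : (FixedPoints.subalgebra k S G)[X], P₀.map (algebraMap _ S) = P ∧ P₀.Monic := by
  obtain ⟨P₀, rfl⟩ := exists_map_algebraMap_eq (k := k) hP
  exact ⟨P₀, rfl, Polynomial.monic_of_injective Subtype.val_injective hm⟩

variable [IsDomain S] [Finite G]

theorem derivative_X_sub_C_mul_eval {S : Type*} [CommRing S] (y : S) (Q : S[X]) :
    ((X - C y) * Q).derivative.eval y = Q.eval y := by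
  simp

/-- A homomorphism that is the identity modulo the variables extends from the invariants of `G`
to the invariants of `Γ`, provided `S^Γ` is generically unramified over `S^G` at `𝔮`. -/
theorem exists_lift_of_isUnramifiedAt (Γ : Subgroup G) {y : S} (hyΓ : ∀ h ∈ Γ, h • y = y)
    (𝔮 : Ideal S) [𝔮.IsPrime] (hy : ∀ g ∉ Γ, y - g • y ∉ 𝔮) {A : Type*} [CommRing A] [Algebra S A]
    (hA : ∀ s ∉ 𝔮, IsUnit (algebraMap S A s)) {σ : Type*} [Finite σ]
    (e₀ : FixedPoints.subalgebra k S G →+* MvPowerSeries σ A)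
    (he₀ : ∀ r, MvPowerSeries.constantCoeff (e₀ r) = algebraMap S A r) :
    ∃ E : FixedPoints.subalgebra k S Γ →+* MvPowerSeries σ A,
      (∀ (r : FixedPoints.subalgebra k S G) (b : FixedPoints.subalgebra k S Γ),
        (b : S) = r → E b = e₀ r) ∧
      ∀ b, MvPowerSeries.constantCoeff (E b) = algebraMap S A b := by
  classical
  have hne : ∀ g : G, g ∉ Γ ↔ g • y ≠ y := fun g => by
    refine ⟨fun hg h => hy g hg (by rw [h, sub_self]; exact 𝔮.zero_mem), fun h hg => h (hyΓ g hg)⟩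
  set Q := orbitCofactor G y with hQ
  have hQy : Q.eval y ∉ 𝔮 := eval_orbitCofactor_notMem y y fun g hg => hy g ((hne g).2 hg)
  have hQΓ : ∀ h ∈ Γ, h • Q = Q := fun h hh => smul_orbitCofactor y (hyΓ h hh)
  obtain ⟨P, hP, hPm⟩ := exists_monic_map_algebraMap_eq (k := k)
    ((monic_X_sub_C y).mul (monic_orbitCofactor (G := G) y)) (smul_X_sub_C_mul_orbitCofactor y)
  rw [← hQ] at hP
  -- the conjugates of `y` are the roots of `P`, hence `P` is minimal
  have hmin : ∀ p : (FixedPoints.subalgebra k S G)[X], p.eval₂ (algebraMap _ S) y = 0 →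
      p.degree < P.degree → p = 0 := by
    intro p hp hdeg
    have hinj : Function.Injective (algebraMap (FixedPoints.subalgebra k S G) S) :=
      Subtype.val_injective
    rw [← Polynomial.map_eq_zero_iff hinj]
    by_contra h0
    have hroots : ∀ c ∈ (Set.finite_range fun g : G => g • y).toFinset,
        (p.map (algebraMap _ S)).eval c = 0 := by
      intro c hc
      rw [Set.Finite.mem_toFinset] at hc
      obtain ⟨g, rfl⟩ := hc
      have : g • p.map (algebraMap _ S) = p.map (algebraMap _ S) := by
        ext n
        rw [Polynomial.coeff_smul, Polynomial.coeff_map]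
        exact (p.coeff n).2 g
      dsimp only
      rw [← this, Polynomial.smul_eval_smul, Polynomial.eval_map, hp, smul_zero]
    apply h0
    apply Polynomial.eq_zero_of_natDegree_lt_card_of_eval_eq_zero' _ _ hroots
    rw [← Polynomial.natDegree_finsetProd_X_sub_C_eq_card _ (fun c => c),
      ← X_sub_C_mul_orbitCofactor, ← hQ, ← hP]
    apply Polynomial.natDegree_lt_natDegree h0
    rwa [Polynomial.degree_map_eq_of_injective hinj, Polynomial.degree_map_eq_of_injective hinj]
  have hπP : P.eval₂ (algebraMap _ S) y = 0 := by
    rw [← Polynomial.eval_map, hP]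
    simp
  have hπP' : P.derivative.eval₂ (algebraMap _ S) y = Q.eval y := by
    rw [← Polynomial.eval_map, ← Polynomial.derivative_map, hP, derivative_X_sub_C_mul_eval]
  -- the root of `P` over the power series ring
  have hcc : ∀ (p : (FixedPoints.subalgebra k S G)[X]) (Y : MvPowerSeries σ A),
      MvPowerSeries.constantCoeff Y = algebraMap S A y →
      MvPowerSeries.constantCoeff (p.eval₂ e₀ Y) =
        algebraMap S A (p.eval₂ (algebraMap _ S) y) := by
    intro p Y hY
    rw [Polynomial.hom_eval₂, Polynomial.hom_eval₂, hY]
    congr 1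
    ext r
    exact he₀ r
  obtain ⟨Y, hPY, hY⟩ : ∃ Y : MvPowerSeries σ A, P.eval₂ e₀ Y = 0 ∧
      MvPowerSeries.constantCoeff Y = algebraMap S A y := by
    have hC : MvPowerSeries.constantCoeff (MvPowerSeries.C (σ := σ) (algebraMap S A y)) =
      algebraMap S A y := MvPowerSeries.constantCoeff_C _
    -- Modulo the variables, `P.map e₀` becomes `P` over `A`, with root `y`; the root is simple
    -- because `P'(y) = Q(y)` lies outside `𝔮` and so becomes a unit of `A`.
    obtain ⟨Y, hY1, hY2⟩ := HenselianRing.is_henselian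
      (I := Ideal.span (Set.range (MvPowerSeries.X : σ → MvPowerSeries σ A)))
      (P.map e₀) (hPm.map e₀) (MvPowerSeries.C (algebraMap S A y))
      (by
        apply mem_span_range_X_of_constantCoeff_eq_zero
        rw [Polynomial.eval_map, hcc _ _ hC, hπP, map_zero])
      (by
        apply IsUnit.map
        rw [MvPowerSeries.isUnit_iff_constantCoeff, Polynomial.derivative_map,
          Polynomial.eval_map, hcc _ _ hC, hπP']
        exact hA _ hQy)
    refine ⟨Y, by rw [← Polynomial.eval_map]; exact hY1, ?_⟩
    rw [← hC, ← sub_eq_zero, ← map_sub]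
    have hle : Ideal.span (Set.range (MvPowerSeries.X : σ → MvPowerSeries σ A)) ≤
        RingHom.ker (MvPowerSeries.constantCoeff) := by
      rw [Ideal.span_le]
      rintro _ ⟨j, rfl⟩
      exact MvPowerSeries.constantCoeff_X j
    exact hle hY2
  have hker : ∀ p : (FixedPoints.subalgebra k S G)[X],
      Polynomial.eval₂RingHom (algebraMap _ S) y p = 0 →
        Polynomial.eval₂RingHom e₀ Y p = 0 := by
    intro p hp
    rw [Polynomial.coe_eval₂RingHom] at hp ⊢
    rw [← Polynomial.modByMonic_add_div p P] at hp ⊢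
    rw [Polynomial.eval₂_add, Polynomial.eval₂_mul, hπP, zero_mul, add_zero] at hp
    rw [Polynomial.eval₂_add, Polynomial.eval₂_mul, hPY, zero_mul, add_zero,
      hmin _ hp (Polynomial.degree_modByMonic_lt p hPm), Polynomial.eval₂_zero]
  -- interpolation
  have hint : ∀ b : FixedPoints.subalgebra k S Γ, ∃ p : (FixedPoints.subalgebra k S G)[X],
      Polynomial.eval₂RingHom (algebraMap _ S) y p =
        Polynomial.eval₂RingHom (algebraMap _ S) y P.derivative * (b : S) := by
    intro b
    have hinv : ∀ h ∈ Γ, h • (C (b : S) * Q) = C (b : S) * Q := fun h hh => by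
      rw [smul_mul', hQΓ h hh, Polynomial.smul_C]
      congr 2
      exact b.2 ⟨h, hh⟩
    -- Lagrange interpolation: `p` is the trace from `Γ` to `G` of `b Q`. For `g ∉ Γ` the conjugate
    -- of `b Q` by `g` vanishes at `y`, so `p(y) = b Q(y) = b P'(y)`.
    obtain ⟨p, hp⟩ := exists_map_algebraMap_eq (k := k) (smul_relTrace Γ hinv)
    refine ⟨p, ?_⟩
    rw [Polynomial.coe_eval₂RingHom, hπP', ← Polynomial.eval_map, hp]
    have := relTrace_eq_of_forall_notMem Γ hinv (Polynomial.evalRingHom y).toAddMonoidHom ?_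
    · refine this.trans ?_
      change (C (b : S) * Q).eval y = _
      rw [Polynomial.eval_mul, Polynomial.eval_C, mul_comm]
    · intro g hg
      change (g • (C (b : S) * Q)).eval y = 0
      have hg' : g⁻¹ • y ≠ y := (hne _).1 (fun h => hg (by simpa using h))
      rw [← smul_inv_smul g y, Polynomial.smul_eval_smul, Polynomial.eval_mul,
        eval_orbitCofactor_smul y hg', mul_zero, smul_zero]
  have hunit : IsUnit (Polynomial.eval₂RingHom e₀ Y P.derivative) := by
    rw [MvPowerSeries.isUnit_iff_constantCoeff, Polynomial.coe_eval₂RingHom, hcc _ _ hY, hπP']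
    exact hA _ hQy
  obtain ⟨E, hE⟩ := exists_ringHom_of_smul_mem_range
    (Polynomial.eval₂RingHom (algebraMap (FixedPoints.subalgebra k S G) S) y)
    (FixedPoints.subalgebra k S Γ).val.toRingHom (Polynomial.eval₂RingHom e₀ Y) hker P.derivative
    hunit hint
  refine ⟨E, fun r b hrb => ?_, fun b => ?_⟩
  · have := hE b (C r * P.derivative) (by
      rw [map_mul, mul_comm]
      congr 1
      rw [Polynomial.coe_eval₂RingHom, Polynomial.eval₂_C]
      exact hrb.symm)
    rw [map_mul, hunit.mul_left_inj] at this
    rw [this, Polynomial.coe_eval₂RingHom, Polynomial.eval₂_C]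
  · obtain ⟨p, hp⟩ := hint b
    have := congrArg MvPowerSeries.constantCoeff (hE b p hp)
    rw [map_mul, Polynomial.coe_eval₂RingHom, hcc _ _ hY, hcc _ _ hY] at this
    rw [Polynomial.coe_eval₂RingHom] at hp
    rw [hp, map_mul, mul_comm, (hA _ (hπP' ▸ hQy)).mul_right_inj] at this
    exact this

/-- Two homomorphisms into a power series ring over a domain that agree on the invariants of `G`
and modulo the variables are equal. -/
theorem ringHom_eq_of_constantCoeff_eq {B : Type*} [CommRing B] (ι : B →+* S) {L : Type*} [Field L]
    (j : S →+* L) (hj : Function.Injective j) {σ : Type*}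
    (i : FixedPoints.subalgebra k S G →+* B) (hi : ∀ r, ι (i r) = r)
    (hι : Function.Injective ι)
    {φ ψ : B →+* MvPowerSeries σ L} (h : ∀ r, φ (i r) = ψ (i r))
    (hφ : ∀ b, MvPowerSeries.constantCoeff (φ b) = j (ι b))
    (hψ : ∀ b, MvPowerSeries.constantCoeff (ψ b) = j (ι b)) : φ = ψ := by
  ext1 b
  -- The orbit polynomial of `ι b` has distinct roots in a domain, so `b` is a simple root. Both
  -- images of `b` are then roots of the same polynomial, congruent modulo the variables, and its
  -- derivative there has nonzero constant coefficient.
  obtain ⟨P, hP⟩ := exists_map_algebraMap_eq (k := k)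
    (smul_X_sub_C_mul_orbitCofactor (G := G) (ι b))
  have hPb : P.eval₂ i b = 0 := by
    apply hι
    rw [Polynomial.hom_eval₂, map_zero]
    have : ι.comp i = algebraMap (FixedPoints.subalgebra k S G) S := RingHom.ext hi
    rw [this, ← Polynomial.eval_map, hP]
    simp
  have hPb' : ι (P.derivative.eval₂ i b) ≠ 0 := by
    rw [Polynomial.hom_eval₂]
    have : ι.comp i = algebraMap (FixedPoints.subalgebra k S G) S := RingHom.ext hi
    rw [this, ← Polynomial.eval_map, ← Polynomial.derivative_map, hP, derivative_X_sub_C_mul_eval]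
    have := eval_orbitCofactor_notMem (G := G) (𝔮 := (⊥ : Ideal S)) (ι b) (ι b)
      (fun g hg h => hg (sub_eq_zero.1 (Ideal.mem_bot.1 h)).symm)
    simpa using this
  have hcomp : φ.comp i = ψ.comp i := RingHom.ext h
  apply eq_of_eval_eq_zero_of_isUnit (P.map (φ.comp i))
  · rw [Polynomial.eval_map, ← Polynomial.hom_eval₂, hPb, map_zero]
  · rw [hcomp, Polynomial.eval_map, ← Polynomial.hom_eval₂, hPb, map_zero]
  · intro c
    rw [MvPowerSeries.isUnit_iff_constantCoeff, map_add, map_mul, map_sub, hφ, hψ, sub_self,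
      mul_zero, add_zero, Polynomial.derivative_map, Polynomial.eval_map, ← Polynomial.hom_eval₂,
      hφ, isUnit_iff_ne_zero]
    exact fun h0 => hPb' (hj (by rw [h0, map_zero]))

end Taylor

/-! ### Invariants that separate cosets modulo a prime -/

section Separation

variable {k S G : Type*} [Field k] [CommRing S] [Algebra k S] [Group G] [Finite G]
  [MulSemiringAction G S] [SMulCommClass G k S]

/-- The characteristic polynomial of `x` under `Γ` has `Γ`-invariant coefficients, which `g` fixes
modulo `𝔮`. So `g • x` is one of its roots modulo `𝔮`, that is, congruent to some `h • x`. A vector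
space over an infinite field is not a finite union of proper subspaces, so a single `h` serves all
`x`. -/
theorem exists_forall_smul_sub_smul_mem [Infinite k] (Γ : Subgroup G) (𝔮 : Ideal S) [𝔮.IsPrime]
    (g : G) (hg : ∀ y : S, (∀ h ∈ Γ, h • y = y) → y - g • y ∈ 𝔮) :
    ∃ h ∈ Γ, ∀ x : S, g • x - h • x ∈ 𝔮 := by
  have := Fintype.ofFinite Γ
  have hx : ∀ x : S, ∃ h : Γ, g • x - h • x ∈ 𝔮 := by
    intro x
    set P := MulSemiringAction.charpoly Γ x with hP
    have h1 : (g • P).eval (g • x) = 0 := by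
      rw [Polynomial.smul_eval_smul, hP, MulSemiringAction.eval_charpoly, smul_zero]
    have h2 : P.map (Ideal.Quotient.mk 𝔮) = (g • P).map (Ideal.Quotient.mk 𝔮) := by
      ext n
      rw [Polynomial.coeff_map, Polynomial.coeff_map, Polynomial.coeff_smul, Ideal.Quotient.eq]
      exact hg _ fun h hh => MulSemiringAction.smul_coeff_charpoly (G := Γ) x n ⟨h, hh⟩
    have h3 : P.eval (g • x) ∈ 𝔮 := by
      rw [← Ideal.Quotient.eq_zero_iff_mem, ← Polynomial.eval₂_at_apply, ← Polynomial.eval_map, h2,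
        Polynomial.eval_map, Polynomial.eval₂_at_apply, h1, map_zero]
    rw [hP, MulSemiringAction.charpoly_eq, Polynomial.eval_prod] at h3
    obtain ⟨h, -, hh⟩ := Ideal.IsPrime.prod_mem_iff.1 h3
    exact ⟨h, by simpa using hh⟩
  let p : Γ → Submodule k S := fun h => (𝔮.restrictScalars k).comap
    (DistribSMul.toLinearMap k S g - DistribSMul.toLinearMap k S (h : G))
  have hp : ⋃ h, (p h : Set S) = Set.univ := by
    rw [Set.eq_univ_iff_forall]
    intro x
    obtain ⟨h, hh⟩ := hx x
    exact Set.mem_iUnion.2 ⟨h, hh⟩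
  obtain ⟨h, hh⟩ := Subspace.exists_eq_top_of_iUnion_eq_univ hp
  refine ⟨h, h.2, fun x => ?_⟩
  have : x ∈ p h := hh ▸ Submodule.mem_top
  exact this

/-- If no such `y` existed, finitely many subspaces would cover the `Γ`-invariants, so one `g ∉ Γ`
would act trivially modulo `𝔮` on all of them; the previous lemma then forces `g ∈ Γ`. -/
theorem exists_forall_sub_smul_notMem [Infinite k] (Γ : Subgroup G) (𝔮 : Ideal S) [𝔮.IsPrime]
    (hΓ : ∀ g : G, (∃ h ∈ Γ, ∀ x : S, g • x - h • x ∈ 𝔮) → g ∈ Γ) :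
    ∃ y : S, (∀ h ∈ Γ, h • y = y) ∧ ∀ g ∉ Γ, y - g • y ∉ 𝔮 := by
  by_contra! hcon
  let p : {g : G // g ∉ Γ} → Submodule k (FixedPoints.subalgebra k S Γ) := fun g =>
    (𝔮.restrictScalars k).comap ((LinearMap.id - DistribSMul.toLinearMap k S (g : G)) ∘ₗ
      (FixedPoints.subalgebra k S Γ).val.toLinearMap)
  have hp : ⋃ g, (p g : Set (FixedPoints.subalgebra k S Γ)) = Set.univ := by
    rw [Set.eq_univ_iff_forall]
    intro y
    obtain ⟨g, hg, hgy⟩ := hcon y fun h hh => y.2 ⟨h, hh⟩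
    exact Set.mem_iUnion.2 ⟨⟨g, hg⟩, hgy⟩
  obtain ⟨g, hg⟩ := Subspace.exists_eq_top_of_iUnion_eq_univ hp
  refine g.2 (hΓ g (exists_forall_smul_sub_smul_mem (k := k) Γ 𝔮 g fun y hy => ?_))
  have : (⟨y, fun h => hy h h.2⟩ : FixedPoints.subalgebra k S Γ) ∈ p g := hg ▸ Submodule.mem_top
  exact this

end Separation

/-! ### The Taylor shift of a polynomial ring of invariants -/

section Shift

variable {k S : Type*} [Field k] [CommRing S] [Algebra k S] {R : Subalgebra k S} {n : ℕ}

/-- The homomorphism `f_i ↦ f_i + t_i` from a polynomial ring `R = k[f_1, …, f_n]`. -/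
def shiftHom (e : R ≃ₐ[k] MvPolynomial (Fin n) k) {A : Type*} [CommRing A] (j : S →+* A) :
    R →+* MvPowerSeries (Fin n) A :=
  (MvPolynomial.eval₂Hom (MvPowerSeries.C.comp (j.comp (algebraMap k S)))
    (fun i => MvPowerSeries.C (j (e.symm (MvPolynomial.X i))) + MvPowerSeries.X i)).comp
    (e : R →+* MvPolynomial (Fin n) k)

theorem shiftHom_congr (e : R ≃ₐ[k] MvPolynomial (Fin n) k) {A : Type*} [CommRing A]
    {j j' : S →+* A} (h : ∀ r : R, j r = j' r) : shiftHom e j = shiftHom e j' := by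
  rw [shiftHom, shiftHom]
  congr 2
  · refine RingHom.ext fun c => ?_
    exact congrArg MvPowerSeries.C (h (algebraMap k R c))
  · funext i
    rw [h]

theorem map_comp_shiftHom (e : R ≃ₐ[k] MvPolynomial (Fin n) k) {A A' : Type*} [CommRing A]
    [CommRing A'] (j : S →+* A) (φ : A →+* A') :
    (MvPowerSeries.map φ).comp (shiftHom e j) = shiftHom e (φ.comp j) := by
  rw [shiftHom, shiftHom, ← RingHom.comp_assoc]
  congr 1
  apply MvPolynomial.ringHom_ext
  · intro c
    simp
  · intro i
    simp

theorem constantCoeff_shiftHom (e : R ≃ₐ[k] MvPolynomial (Fin n) k) {A : Type*} [CommRing A]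
    (j : S →+* A) (r : R) : MvPowerSeries.constantCoeff (shiftHom e j r) = j r := by
  obtain ⟨p, rfl⟩ := e.symm.surjective r
  have : (MvPowerSeries.constantCoeff.comp (shiftHom e j)).comp
      (e.symm : MvPolynomial (Fin n) k →+* R) =
      (j.comp R.val.toRingHom).comp (e.symm : MvPolynomial (Fin n) k →+* R) := by
    apply MvPolynomial.ringHom_ext
    · intro c
      have h1 : e.symm (MvPolynomial.C c) = algebraMap k R c := e.symm.commutes c
      simp [shiftHom, h1]
    · intro i
      simp [shiftHom]
  exact congrArg (fun f => f p) this

/-- With scalar constant terms the shift is a translation automorphism of the polynomial ring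
followed by its inclusion into power series. -/
theorem shiftHom_injective (e : R ≃ₐ[k] MvPolynomial (Fin n) k) (ε : S →ₐ[k] k) :
    Function.Injective (shiftHom e (ε : S →+* k)) := by
  let c : Fin n → k := fun i => ε (e.symm (MvPolynomial.X i))
  let τ : (Fin n → k) → MvPolynomial (Fin n) k →ₐ[k] MvPolynomial (Fin n) k := fun c =>
    MvPolynomial.aeval fun i => MvPolynomial.C (c i) + MvPolynomial.X i
  have hτ : (τ (-c)).comp (τ c) = AlgHom.id k _ := by
    apply MvPolynomial.algHom_ext
    intro i
    simp [τ]
  have hinj : Function.Injective (τ c) := by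
    apply Function.LeftInverse.injective (g := τ (-c))
    exact fun p => congrArg (fun f => f p) hτ
  have heq : shiftHom e (ε : S →+* k) =
      ((MvPolynomial.coeToMvPowerSeries.ringHom (σ := Fin n) (R := k)).comp
        (τ c : MvPolynomial (Fin n) k →+* MvPolynomial (Fin n) k)).comp
        (e : R →+* MvPolynomial (Fin n) k) := by
    rw [shiftHom]
    congr 1
    apply MvPolynomial.ringHom_ext
    · intro a
      simp [τ]
    · intro i
      simp [τ, c]
  rw [heq]
  exact ((MvPolynomial.coe_injective (Fin n) k).comp hinj).comp e.injective

end Shift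

/-! ### Serre's theorem: generation by inertia groups -/

section Generation

variable {k S G : Type*} [Field k] [CommRing S] [IsDomain S] [Algebra k S] [Group G] [Finite G]
  [MulSemiringAction G S] [SMulCommClass G k S]

/-- A prime factor of the denominator of a reduced fraction contradicts the hypothesis at that
prime. This is how power series coefficients are shown to lie in `S`. -/
theorem mem_range_algebraMap_of_forall_prime [UniqueFactorizationMonoid S] {L : Type*} [Field L]
    [Algebra S L] [IsFractionRing S L] (x : L)
    (hx : ∀ q : S, Prime q → ∃ a c : S, ¬ q ∣ c ∧ x * algebraMap S L c = algebraMap S L a) :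
    x ∈ Set.range (algebraMap S L) := by
  obtain ⟨a, b, hab, hb, rfl⟩ := IsFractionRing.exists_reduced_fraction (A := S) x |>
    fun ⟨a, b, hab, h⟩ => (⟨a, b, hab, b.2, h⟩ :
      ∃ (a : S) (b : nonZeroDivisors S), IsRelPrime a b ∧ (b : S) ∈ nonZeroDivisors S ∧
        IsLocalization.mk' L a b = x)
  have hinj := IsFractionRing.injective S L
  have hb0 : algebraMap S L b ≠ 0 := by
    simp
  have hbu : IsUnit (b : S) := by
    by_contra hu
    obtain ⟨q, hq, hqb⟩ := WfDvdMonoid.exists_irreducible_factor hu (nonZeroDivisors.ne_zero hb)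
    obtain ⟨a', c, hc, h⟩ := hx q (UniqueFactorizationMonoid.irreducible_iff_prime.1 hq)
    have h2 : a * c = a' * b := by
      apply hinj
      rw [map_mul, map_mul, ← h, mul_right_comm, IsLocalization.mk'_spec]
    have hqa : q ∣ a := by
      have : q ∣ a * c := h2 ▸ dvd_mul_of_dvd_right hqb _
      exact ((UniqueFactorizationMonoid.irreducible_iff_prime.1 hq).dvd_or_dvd this).resolve_right hc
    exact hq.not_isUnit (hab hqa hqb)
  obtain ⟨u, hu⟩ := hbu
  refine ⟨a * ↑u⁻¹, ?_⟩
  rw [IsLocalization.eq_mk'_iff_mul_eq, ← map_mul, ← hu, Units.inv_mul_cancel_right]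

/-- **Serre's theorem**: if the ring of invariants is polynomial, then `G` is generated by the
inertia groups of the principal prime ideals. -/
theorem eq_top_of_isPolynomialRing [Infinite k] [UniqueFactorizationMonoid S] [FaithfulSMul G S]
    (ε : S →ₐ[k] k) (hε : ∀ (g : G) s, ε (g • s) = ε s) (H : Subgroup G) [H.Normal]
    (hH : ∀ q : S, Prime q → ∀ g : G, (∀ x : S, q ∣ g • x - x) → g ∈ H)
    (hpoly : IsPolynomialRing k (FixedPoints.subalgebra k S G)) : H = ⊤ := by
  obtain ⟨n, ⟨e⟩⟩ := hpoly
  let L := FractionRing S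
  let R := FixedPoints.subalgebra k S G
  let B := FixedPoints.subalgebra k S H
  have hinj : Function.Injective (algebraMap S L) := IsFractionRing.injective S L
  let i : R →+* B := (Subalgebra.inclusion (S := R) (T := B) fun r hr h => hr h).toRingHom
  have hi : ∀ r : R, ((i r : B) : S) = r := fun r => rfl
  -- the lift over the fraction field
  obtain ⟨y, hyH, hy⟩ := exists_forall_sub_smul_notMem (k := k) H (⊥ : Ideal S) (by
    rintro g ⟨h, hh, hgh⟩
    have : g = h := FaithfulSMul.eq_of_smul_eq_smul (α := S) fun x => sub_eq_zero.1 (hgh x)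
    rwa [this])
  obtain ⟨E₀, hE₀R, hE₀c⟩ := exists_lift_of_isUnramifiedAt (k := k) H hyH (⊥ : Ideal S) hy (A := L)
    (fun s hs => isUnit_iff_ne_zero.2 fun h => hs (hinj (by rw [h, map_zero])))
    (shiftHom e (algebraMap S L)) (constantCoeff_shiftHom e _)
  -- its coefficients lie in `S`
  have hcoeff : ∀ (b : B) (m : Fin n →₀ ℕ),
      MvPowerSeries.coeff m (E₀ b) ∈ Set.range (algebraMap S L) := by
    intro b m
    apply mem_range_algebraMap_of_forall_prime
    intro q hq
    let 𝔮 : Ideal S := Ideal.span {q}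
    have h𝔮 : 𝔮.IsPrime := (Ideal.span_singleton_prime hq.ne_zero).2 hq
    -- The inertia group of `𝔮`. It lies in `H`, so `S^H ⊆ S^Γ`, and the shift extends to `S^Γ` with
    -- coefficients in the local ring at `𝔮`.
    let Γ : Subgroup G := 
      { carrier := {g | ∀ x : S, g • x - x ∈ 𝔮}
        mul_mem' := fun {a b} ha hb x => by
          have := 𝔮.add_mem (ha (b • x)) (hb x)
          rwa [sub_add_sub_cancel, smul_smul] at this
        one_mem' := fun x => by simp
        inv_mem' := fun {a} ha x => by
          have := 𝔮.neg_mem (ha (a⁻¹ • x))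
          rwa [smul_inv_smul, neg_sub] at this }
    have hΓH : Γ ≤ H := fun g hg => hH q hq g fun x => Ideal.mem_span_singleton.1 (hg x)
    obtain ⟨z, hzΓ, hz⟩ := exists_forall_sub_smul_notMem (k := k) Γ 𝔮 (by
      rintro g ⟨h, hh, hgh⟩ x
      have := 𝔮.add_mem (hgh x) (hh x)
      rwa [sub_add_sub_cancel] at this)
    obtain ⟨E₁, hE₁R, hE₁c⟩ := exists_lift_of_isUnramifiedAt (k := k) Γ hzΓ 𝔮 hz
      (A := Localization.AtPrime 𝔮)
      (fun s hs => IsLocalization.map_units (Localization.AtPrime 𝔮) (⟨s, hs⟩ : 𝔮.primeCompl))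
      (shiftHom e (algebraMap S (Localization.AtPrime 𝔮))) (constantCoeff_shiftHom e _)
    have hu : ∀ s : 𝔮.primeCompl, IsUnit (algebraMap S L s) := fun s =>
      isUnit_iff_ne_zero.2 fun h => s.2 (by
        rw [hinj (h.trans (map_zero _).symm)]
        exact 𝔮.zero_mem)
    let j : Localization.AtPrime 𝔮 →+* L := IsLocalization.lift hu
    have hj : j.comp (algebraMap S (Localization.AtPrime 𝔮)) = algebraMap S L :=
      IsLocalization.lift_comp hu
    let κ : B →+* FixedPoints.subalgebra k S Γ :=
      (Subalgebra.inclusion (S := B) (T := FixedPoints.subalgebra k S Γ)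
        fun r hr h => hr ⟨h, hΓH h.2⟩).toRingHom
    -- Uniqueness of the extension identifies the generic lift with the one at `𝔮`, whose
    -- coefficients have denominators prime to `q`.
    have heq : E₀ = (MvPowerSeries.map j).comp (E₁.comp κ) := by
      apply ringHom_eq_of_constantCoeff_eq (k := k) (G := G) B.val.toRingHom (algebraMap S L) hinj
        i hi Subtype.val_injective
      · intro r
        rw [hE₀R r (i r) rfl]
        change _ = (MvPowerSeries.map j) (E₁ (κ (i r)))
        rw [hE₁R r (κ (i r)) rfl, ← RingHom.comp_apply, map_comp_shiftHom, hj]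
      · exact hE₀c
      · intro b
        change MvPowerSeries.constantCoeff (MvPowerSeries.map j (E₁ (κ b))) = _
        rw [MvPowerSeries.constantCoeff_map, hE₁c, ← RingHom.comp_apply, hj]
        rfl
    rw [heq]
    change ∃ a c, _ ∧ MvPowerSeries.coeff m (MvPowerSeries.map j (E₁ (κ b))) * _ = _
    rw [MvPowerSeries.coeff_map]
    obtain ⟨⟨a, c⟩, hac⟩ := IsLocalization.surj 𝔮.primeCompl (MvPowerSeries.coeff m (E₁ (κ b)))
    refine ⟨a, c, fun h => c.2 (Ideal.mem_span_singleton.2 h), ?_⟩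
    rw [← hj, RingHom.comp_apply, RingHom.comp_apply, ← map_mul, hac]
  obtain ⟨E, hE⟩ : ∃ E : B →+* MvPowerSeries (Fin n) S,
      (MvPowerSeries.map (algebraMap S L)).comp E = E₀ := by
    have hmem : ∀ b, E₀ b ∈ (MvPowerSeries.map (σ := Fin n) (algebraMap S L)).range := by
      intro b
      choose f hf using hcoeff b
      exact ⟨f, MvPowerSeries.ext hf⟩
    have hinj' : Function.Injective (MvPowerSeries.map (σ := Fin n) (algebraMap S L)) := by
      intro f g hfg
      ext m
      apply hinj
      rw [← MvPowerSeries.coeff_map, hfg, MvPowerSeries.coeff_map]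
    refine ⟨((RingEquiv.ofLeftInverse (Function.leftInverse_invFun hinj')).symm :
      (MvPowerSeries.map (σ := Fin n) (algebraMap S L)).range →+* _).comp
      (E₀.codRestrict _ hmem), ?_⟩
    ext1 b
    exact congrArg Subtype.val ((RingEquiv.ofLeftInverse
      (Function.leftInverse_invFun hinj')).apply_symm_apply ⟨E₀ b, hmem b⟩)
  have hLinj : Function.Injective (MvPowerSeries.map (σ := Fin n) (algebraMap S L)) := by
    intro f g hfg
    ext m
    apply hinj
    rw [← MvPowerSeries.coeff_map, hfg, MvPowerSeries.coeff_map]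
  have hEi : ∀ r, E (i r) = shiftHom e (RingHom.id S) r := by
    intro r
    apply hLinj
    rw [← RingHom.comp_apply (MvPowerSeries.map _) E, hE, hE₀R r (i r) rfl, ← RingHom.comp_apply,
      map_comp_shiftHom, RingHom.comp_id]
  have hEc : ∀ b, MvPowerSeries.constantCoeff (E b) = b := by
    intro b
    apply hinj
    rw [← hE₀c, ← hE]
    exact (MvPowerSeries.constantCoeff_map _ _).symm
  -- equivariance
  let γ : G → B →+* B := fun g =>
    ((MulSemiringAction.toRingHom G S g).comp B.val.toRingHom).codRestrict B.toSubring
      (fun b h => by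
        have := b.2 ⟨_, ‹H.Normal›.conj_mem' _ h.2 g⟩
        change (h : G) • g • (b : S) = g • (b : S)
        change (g⁻¹ * h * g) • (b : S) = b at this
        rw [mul_smul, mul_smul, inv_smul_eq_iff] at this
        exact this)
  have hγ : ∀ g b, ((γ g b : B) : S) = g • (b : S) := fun g b => rfl
  -- Evaluating the coefficients at a fixed point of `G` removes the only dependence of `E` on the
  -- group element.
  let T : B →+* MvPowerSeries (Fin n) k := (MvPowerSeries.map (ε : S →+* k)).comp E
  have hT : ∀ g b, T (γ g b) = T b := by
    intro g b
    let γ' := MulSemiringAction.toRingHom G S g⁻¹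
    -- The conjugate of `E` by `g` agrees with `E` on `S^G` and modulo the variables, hence
    -- everywhere.
    have heq : (MvPowerSeries.map (algebraMap S L)).comp
        ((MvPowerSeries.map γ').comp (E.comp (γ g))) =
        (MvPowerSeries.map (algebraMap S L)).comp E := by
      apply ringHom_eq_of_constantCoeff_eq (k := k) (G := G) B.val.toRingHom (algebraMap S L) hinj
        i hi Subtype.val_injective
      · intro r
        have h1 : γ g (i r) = i r := Subtype.ext (r.2 g)
        simp only [RingHom.comp_apply]
        rw [h1, hEi, ← RingHom.comp_apply (MvPowerSeries.map γ'), map_comp_shiftHom]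
        congr 2
        apply shiftHom_congr
        exact fun r => r.2 g⁻¹
      · intro b
        simp only [RingHom.comp_apply, MvPowerSeries.constantCoeff_map, hEc, hγ]
        exact congrArg _ (inv_smul_smul g (b : S))
      · intro b
        simp only [RingHom.comp_apply, MvPowerSeries.constantCoeff_map, hEc]
        rfl
    have h2 : MvPowerSeries.map γ' (E (γ g b)) = E b :=
      hLinj (congrArg (fun f => f b) heq)
    have h3 : (ε : S →+* k).comp γ' = (ε : S →+* k) := RingHom.ext fun s => hε g⁻¹ s
    change MvPowerSeries.map (ε : S →+* k) _ = MvPowerSeries.map (ε : S →+* k) _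
    rw [← h2, ← RingHom.comp_apply (MvPowerSeries.map _) (MvPowerSeries.map _),
      ← MvPowerSeries.map_comp, h3]
  have hTi : ∀ r, T (i r) = shiftHom e (ε : S →+* k) r := by
    intro r
    change MvPowerSeries.map (ε : S →+* k) (E (i r)) = _
    rw [hEi, ← RingHom.comp_apply, map_comp_shiftHom, RingHom.comp_id]
  -- The norm of `b` lies in `S^G`, where `T` is the injective shift, and `T` sends it to a power of
  -- `T b`.
  have hT0 : ∀ b, T b = 0 → b = 0 := by
    intro b hb
    have := Fintype.ofFinite G
    let N : R := ⟨∏ g : G, g • (b : S), fun g => by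
      rw [Finset.smul_prod']
      exact Fintype.prod_equiv (Equiv.mulLeft g) _ _ fun h => by
        rw [smul_smul]
        rfl⟩
    have hN : i N = ∏ g : G, γ g b := by
      apply Subtype.val_injective
      change _ = B.val (∏ g : G, γ g b)
      rw [map_prod]
      rfl
    have hN0 : N = 0 := by
      apply shiftHom_injective e ε
      rw [← hTi, hN, map_prod, map_zero]
      simp only [hT, hb]
      simp
    have h0 : ∏ g : G, g • (b : S) = 0 := congrArg Subtype.val hN0
    obtain ⟨g, -, hg⟩ := Finset.prod_eq_zero_iff.1 h0
    exact Subtype.ext ((smul_eq_zero_iff_eq g).1 hg)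
  rw [eq_top_iff]
  intro g _
  by_contra hg
  -- By injectivity of `T`, the element `g` fixes `y`, which was chosen to be moved by everything
  -- outside `H`.
  have h1 : T (γ g ⟨y, fun h => hyH h h.2⟩ - ⟨y, fun h => hyH h h.2⟩) = 0 := by
    rw [map_sub, hT, sub_self]
  have h2 := congrArg Subtype.val (hT0 _ h1)
  apply hy g hg
  rw [Ideal.mem_bot, sub_eq_zero]
  exact (sub_eq_zero.1 h2).symm

end Generation

/-! ### Cotangent spaces at rational points and regularity -/

section Cotangent

variable {k A B : Type*} [Field k] [CommRing A] [CommRing B] [Algebra k A] [Algebra k B]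

theorem sub_algebraMap_mem_ker (ε : A →ₐ[k] k) (a : A) :
    a - algebraMap k A (ε a) ∈ RingHom.ker ε := by
  rw [RingHom.mem_ker, map_sub, AlgHom.commutes]
  exact sub_self _

/-- A coefficient `b` may be replaced by the scalar `ε b`, since the difference lies in the maximal
ideal. -/
theorem exists_sub_mem_ker_sq_of_mem_map (f : A →ₐ[k] B) (ε : B →ₐ[k] k) {z : B}
    (hz : z ∈ (RingHom.ker (ε.comp f)).map f) :
    ∃ a ∈ RingHom.ker (ε.comp f), z - f a ∈ RingHom.ker ε ^ 2 := by
  refine Submodule.span_induction ?_ ?_ ?_ ?_ hz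
  · rintro _ ⟨a, ha, rfl⟩
    exact ⟨a, ha, by simp⟩
  · exact ⟨0, Ideal.zero_mem _, by simp⟩
  · rintro x y _ _ ⟨a, ha, hxa⟩ ⟨b, hb, hyb⟩
    refine ⟨a + b, Ideal.add_mem _ ha hb, ?_⟩
    rw [map_add, add_sub_add_comm]
    exact Ideal.add_mem _ hxa hyb
  · rintro b x _ ⟨a, ha, hxa⟩
    refine ⟨algebraMap k A (ε b) * a, Ideal.mul_mem_left _ _ ha, ?_⟩
    have h1 : b • x - f (algebraMap k A (ε b) * a) =
        b * (x - f a) + (b - algebraMap k B (ε b)) * f a := by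
      rw [map_mul, AlgHom.commutes, smul_eq_mul]
      ring
    rw [h1]
    refine Ideal.add_mem _ (Ideal.mul_mem_left _ _ hxa) ?_
    rw [sq]
    exact Ideal.mul_mem_mul (sub_algebraMap_mem_ker ε b) ha

theorem mem_ker_sq_of_mul_mem (ε : A →ₐ[k] k) {c a : A} (hc : ε c ≠ 0) (ha : a ∈ RingHom.ker ε)
    (h : c * a ∈ RingHom.ker ε ^ 2) : a ∈ RingHom.ker ε ^ 2 := by
  have h1 : a = algebraMap k A (ε c)⁻¹ * (c * a - (c - algebraMap k A (ε c)) * a) := by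
    rw [← sub_mul, sub_sub_cancel, ← mul_assoc, ← map_mul, inv_mul_cancel₀ hc, map_one, one_mul]
  rw [h1]
  refine Ideal.mul_mem_left _ _ (Ideal.sub_mem _ h ?_)
  rw [sq]
  exact Ideal.mul_mem_mul (sub_algebraMap_mem_ker ε c) ha

/-- A criterion for a homomorphism to induce an isomorphism of cotangent spaces at rational
points. -/
theorem finrank_cotangent_eq (f : A →ₐ[k] B) (ε : B →ₐ[k] k)
    (hinj : ∀ r, f r ∈ RingHom.ker ε ^ 2 → ∃ c, ε (f c) ≠ 0 ∧ c * r ∈ RingHom.ker (ε.comp f) ^ 2)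
    (hsurj : ∀ b ∈ RingHom.ker ε, ∃ c, ε c ≠ 0 ∧ c * b ∈ (RingHom.ker (ε.comp f)).map f) :
    Module.finrank k (RingHom.ker (ε.comp f)).Cotangent =
      Module.finrank k (RingHom.ker ε).Cotangent := by
  let L := Ideal.mapCotangent (RingHom.ker (ε.comp f)) (RingHom.ker ε) f (fun _ h => h)
  refine (LinearEquiv.ofBijective L ⟨?_, ?_⟩).finrank_eq
  · rw [injective_iff_map_eq_zero]
    intro x hx
    obtain ⟨x, rfl⟩ := Ideal.toCotangent_surjective _ x
    replace hx : Ideal.toCotangent (RingHom.ker ε) ⟨f x, x.2⟩ = 0 := hx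
    rw [Ideal.toCotangent_eq_zero] at hx
    rw [Ideal.toCotangent_eq_zero]
    obtain ⟨c, hc, h⟩ := hinj _ hx
    exact mem_ker_sq_of_mul_mem (ε.comp f) hc x.2 h
  · intro y
    obtain ⟨y, rfl⟩ := Ideal.toCotangent_surjective _ y
    obtain ⟨c, hc, h⟩ := hsurj _ y.2
    obtain ⟨a, ha, hya⟩ := exists_sub_mem_ker_sq_of_mem_map f ε h
    refine ⟨Ideal.toCotangent _ ⟨algebraMap k A (ε c)⁻¹ * a, Ideal.mul_mem_left _ _ ha⟩, ?_⟩
    refine (Ideal.toCotangent_eq _ (x := ⟨f (algebraMap k A (ε c)⁻¹ * a), _⟩)).2 ?_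
    have hfa : f (algebraMap k A (ε c)⁻¹ * a) = algebraMap k B (ε c)⁻¹ * f a := by
      rw [map_mul, AlgHom.commutes]
    have hc' : ε (algebraMap k B (ε c)) ≠ 0 := by
      rwa [AlgHom.commutes]
    have hmem : f (algebraMap k A (ε c)⁻¹ * a) ∈ RingHom.ker ε := by
      rw [hfa]
      exact Ideal.mul_mem_left _ _ ha
    refine mem_ker_sq_of_mul_mem ε hc' (Ideal.sub_mem _ hmem y.2) ?_
    · have h1 : algebraMap k B (ε c) * (f (algebraMap k A (ε c)⁻¹ * a) - y) =
          -(c * y - f a) + (c - algebraMap k B (ε c)) * y := by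
        rw [hfa, mul_sub, ← mul_assoc, ← map_mul, mul_inv_cancel₀ hc, map_one]
        ring
      rw [h1]
      refine Ideal.add_mem _ (Ideal.neg_mem_iff _ |>.2 hya) ?_
      rw [sq]
      exact Ideal.mul_mem_mul (sub_algebraMap_mem_ker ε c) y.2

instance isMaximal_ker_algHom (ε : A →ₐ[k] k) : (RingHom.ker ε).IsMaximal :=
  RingHom.ker_isMaximal_of_surjective ε fun c => ⟨algebraMap k A c, ε.commutes c⟩

/-- Localizing at the point does not change the cotangent space, and the residue field is `k`, so
the embedding dimension can be computed over `k` in `A` itself. This reduces regularity to a count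
of dimensions. -/
theorem isRegularLocalRing_localization_iff [IsNoetherianRing A] (ε : A →ₐ[k] k) :
    IsRegularLocalRing (Localization.AtPrime (RingHom.ker ε)) ↔
      (Module.finrank k (RingHom.ker ε).Cotangent : ℕ∞) = (RingHom.ker ε).height := by
  let Am := Localization.AtPrime (RingHom.ker ε)
  have : IsNoetherianRing Am := IsLocalization.isNoetherianRing (RingHom.ker ε).primeCompl _ ‹_›
  rw [IsRegularLocalRing.iff_finrank_cotangentSpace,
    IsLocalization.AtPrime.ringKrullDim_eq_height (RingHom.ker ε) Am]
  let ε' : Am →ₐ[k] k := IsLocalization.liftAlgHom (M := (RingHom.ker ε).primeCompl) (f := ε)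
    fun s => isUnit_iff_ne_zero.2 s.2
  let f : A →ₐ[k] Am := IsScalarTower.toAlgHom k A Am
  have hcomp : ε'.comp f = ε := by
    ext a
    exact IsLocalization.lift_eq _ a
  have hmax : RingHom.ker ε' = IsLocalRing.maximalIdeal Am :=
    IsLocalRing.eq_maximalIdeal inferInstance
  have hmap : (RingHom.ker ε).map f = IsLocalRing.maximalIdeal Am :=
    Localization.AtPrime.map_eq_maximalIdeal
  have heqI : ∀ I : Ideal Am, I = IsLocalRing.maximalIdeal Am →
      Module.finrank k I.Cotangent = Module.finrank k (IsLocalRing.CotangentSpace Am) := by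
    rintro _ rfl
    rfl
  have h1 : Module.finrank k (RingHom.ker ε).Cotangent =
      Module.finrank k (IsLocalRing.CotangentSpace Am) := by
    rw [← heqI _ hmax]
    have := finrank_cotangent_eq f ε' ?_ ?_
    · rwa [hcomp] at this
    · intro r hr
      rw [hmax, ← hmap, ← Ideal.map_pow] at hr
      obtain ⟨⟨c, s⟩, hcs⟩ :=
        (IsLocalization.mem_map_algebraMap_iff (RingHom.ker ε).primeCompl Am).1 hr
      have h2 : algebraMap A Am (r * s) = algebraMap A Am c := by
        rw [map_mul]
        exact hcs
      obtain ⟨t, ht⟩ := (IsLocalization.eq_iff_exists (RingHom.ker ε).primeCompl Am).1 h2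
      have hf : ∀ a, ε' (f a) = ε a := fun a => congrArg (fun φ => φ a) hcomp
      refine ⟨t * s, ?_, ?_⟩
      · rw [hf]
        exact fun h => (t * s).2 h
      · rw [hcomp, mul_assoc, mul_comm (s : A), ht]
        exact Ideal.mul_mem_left _ _ c.2
    · intro b hb
      refine ⟨1, by simp, ?_⟩
      rwa [one_mul, hcomp, hmap, ← hmax]
  let κ := IsLocalRing.ResidueField Am
  have hsurj : ∀ x : κ, ∃ c : k, algebraMap k κ c = x := by
    intro x
    obtain ⟨a, rfl⟩ := IsLocalRing.residue_surjective x
    refine ⟨ε' a, ?_⟩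
    rw [IsScalarTower.algebraMap_apply k Am κ, eq_comm, ← sub_eq_zero]
    change IsLocalRing.residue Am a - IsLocalRing.residue Am _ = 0
    rw [← map_sub, IsLocalRing.residue_eq_zero_iff, ← hmax]
    exact sub_algebraMap_mem_ker ε' a
  have htower : IsScalarTower k κ (IsLocalRing.CotangentSpace Am) :=
    IsScalarTower.of_algebraMap_smul fun c x => by
      rw [IsScalarTower.algebraMap_apply k Am κ, algebraMap_smul, algebraMap_smul]
  have hκ : Module.finrank k κ = 1 :=
    (finrank_eq_one_iff_of_nonzero' (1 : κ) one_ne_zero).2 fun x => by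
      obtain ⟨c, hc⟩ := hsurj x
      exact ⟨c, by rw [Algebra.smul_def, hc, mul_one]⟩
  have h2 := Module.finrank_mul_finrank k κ (IsLocalRing.CotangentSpace Am)
  rw [hκ, one_mul] at h2
  rw [h1, ← h2]
  exact WithBot.coe_inj

end Cotangent

/-! ### Comparing the quotients by a group and by a subgroup -/

section Transfer

variable {k S G : Type*} [Field k] [CommRing S] [Algebra k S] [Group G] [Finite G]
  [MulSemiringAction G S] [SMulCommClass G k S]

/-- If the action of `G` is free along `G/Γ` at a rational point, then the quotients by `Γ` and
by `G` have the same cotangent space there. -/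
theorem finrank_cotangent_invariants_eq (ε : S →ₐ[k] k) (Γ : Subgroup G) {z : S}
    (hzΓ : ∀ h ∈ Γ, h • z = z) (hz : ε z = 1) (hz' : ∀ g ∉ Γ, ε (g • z) = 0) :
    Module.finrank k (RingHom.ker (ε.comp (FixedPoints.subalgebra k S G).val)).Cotangent =
      Module.finrank k (RingHom.ker (ε.comp (FixedPoints.subalgebra k S Γ).val)).Cotangent := by
  let R := FixedPoints.subalgebra k S G
  let B := FixedPoints.subalgebra k S Γ
  let i : R →ₐ[k] B := Subalgebra.inclusion (S := R) (T := B) fun r hr h => hr h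
  let εB : B →ₐ[k] k := ε.comp B.val
  have hi : ∀ r : R, ((i r : B) : S) = r := fun r => rfl
  have hB : ∀ (b : B), ∀ h ∈ Γ, h • (b : S) = b := fun b h hh => b.2 ⟨h, hh⟩
  let zB : B := ⟨z, fun h => hzΓ h h.2⟩
  let tr : B → R := fun b => ⟨relTrace Γ (b : S), fun g => smul_relTrace Γ (hB b) g⟩
  have htr0 : tr 0 = 0 := Subtype.ext (by simp [tr, relTrace])
  have htradd : ∀ a b, tr (a + b) = tr a + tr b := fun a b =>
    Subtype.ext (by simp [tr, relTrace, Finset.sum_add_distrib])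
  have htrmul : ∀ (r : R) b, tr (i r * b) = r * tr b := fun r b =>
    Subtype.ext (relTrace_mul_left Γ r.2 (b : S))
  have htrε : ∀ b, ε (tr (zB * b)) = εB b := by
    intro b
    have := relTrace_eq_of_forall_notMem Γ (hB (zB * b)) (ε : S →+* k).toAddMonoidHom ?_
    · refine this.trans ?_
      change ε (z * b) = ε b
      rw [map_mul, hz, one_mul]
    · intro g hg
      change ε (g • (z * b)) = 0
      rw [smul_mul', map_mul, hz' g hg, zero_mul]
  have hzB : εB zB = 1 := hz
  -- Up to sign, the product of the distinct conjugates of `y` is a `G`-invariant vanishing at the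
  -- point. It equals `y` times a factor that does not vanish there, because the other conjugates
  -- take the value 1.
  have hcop : ∀ y : B, εB y = 0 → (∀ g ∉ Γ, ε (g • (y : S)) = 1) →
      ∃ c, εB c ≠ 0 ∧ c * y ∈ (RingHom.ker (εB.comp i)).map i := by
    intro y hy hy'
    have hne : ∀ g : G, g • (y : S) ≠ y → g ∉ Γ := fun g hg h => hg (hB y g h)
    obtain ⟨P, hP⟩ := exists_map_algebraMap_eq (k := k)
      (smul_X_sub_C_mul_orbitCofactor (G := G) (y : S))
    let c : B := ⟨(orbitCofactor G (y : S)).eval 0, fun h => by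
      have h1 := smul_orbitCofactor (y : S) (hB y h h.2)
      conv_rhs => rw [← h1, ← smul_zero (h : G), Polynomial.smul_eval_smul]
      rfl⟩
    have hcy : c * y = i (-P.eval 0) := by
      apply Subtype.ext
      change (orbitCofactor G (y : S)).eval 0 * (y : S) = algebraMap R S (-P.eval 0)
      rw [map_neg, ← Polynomial.eval₂_at_apply, map_zero, ← Polynomial.eval_map, hP,
        Polynomial.eval_mul]
      simp [mul_comm]
    refine ⟨c, ?_, ?_⟩
    · refine eval_orbitCofactor_notMem (𝔮 := RingHom.ker ε) 0 (y : S) fun g hg h => ?_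
      rw [RingHom.mem_ker, zero_sub, map_neg, hy' g (hne g hg)] at h
      simp at h
    · rw [hcy]
      apply Ideal.mem_map_of_mem
      change εB (i (-P.eval 0)) = 0
      rw [← hcy, map_mul, hy, mul_zero]
  -- Both `z b + (1 - z)` and `1 - z` vanish at the point and take the value 1 at its translates, so
  -- `hcop` applies to each; their difference is `z b`, and `z` is 1 at the point.
  have hsurj : ∀ b ∈ RingHom.ker εB, ∃ c, εB c ≠ 0 ∧ c * b ∈ (RingHom.ker (εB.comp i)).map i := by
    intro b hb
    obtain ⟨c₁, hc₁, h₁⟩ := hcop (zB * b + (1 - zB)) (by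
      rw [map_add, map_mul, map_sub, map_one, hzB, one_mul, sub_self, add_zero]
      exact hb) (by
      intro g hg
      change ε (g • (z * b + (1 - z))) = 1
      rw [smul_add, smul_mul', smul_sub, smul_one, map_add, map_mul, map_sub, hz' g hg]
      simp)
    obtain ⟨c₂, hc₂, h₂⟩ := hcop (1 - zB) (by
      rw [map_sub, map_one, hzB, sub_self]) (by
      intro g hg
      change ε (g • (1 - z)) = 1
      rw [smul_sub, smul_one, map_sub, hz' g hg]
      simp)
    refine ⟨c₁ * c₂ * zB, ?_, ?_⟩
    · rw [map_mul, map_mul, hzB, mul_one]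
      exact mul_ne_zero hc₁ hc₂
    · have h3 : c₁ * c₂ * zB * b =
          c₂ * (c₁ * (zB * b + (1 - zB))) - c₁ * (c₂ * (1 - zB)) := by ring
      rw [h3]
      exact Ideal.sub_mem _ (Ideal.mul_mem_left _ _ h₁) (Ideal.mul_mem_left _ _ h₂)
  refine finrank_cotangent_eq i εB ?_ hsurj
  intro r hr
  have hsq : ∀ b ∈ RingHom.ker εB ^ 2,
      ∃ c, εB c ≠ 0 ∧ c * b ∈ (RingHom.ker (εB.comp i) ^ 2).map i := by
    intro b hb
    rw [sq] at hb
    refine Submodule.mul_induction_on hb ?_ ?_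
    · intro b₁ h₁ b₂ h₂
      obtain ⟨c₁, hc₁, h₁⟩ := hsurj b₁ h₁
      obtain ⟨c₂, hc₂, h₂⟩ := hsurj b₂ h₂
      refine ⟨c₁ * c₂, by rw [map_mul]; exact mul_ne_zero hc₁ hc₂, ?_⟩
      rw [mul_mul_mul_comm, Ideal.map_pow, sq]
      exact Ideal.mul_mem_mul h₁ h₂
    · rintro b₁ b₂ ⟨c₁, hc₁, h₁⟩ ⟨c₂, hc₂, h₂⟩
      refine ⟨c₁ * c₂, by rw [map_mul]; exact mul_ne_zero hc₁ hc₂, ?_⟩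
      have : c₁ * c₂ * (b₁ + b₂) = c₂ * (c₁ * b₁) + c₁ * (c₂ * b₂) := by ring
      rw [this]
      exact Ideal.add_mem _ (Ideal.mul_mem_left _ _ h₁) (Ideal.mul_mem_left _ _ h₂)
  have htrmem : ∀ x ∈ (RingHom.ker (εB.comp i) ^ 2).map i, ∀ b,
      tr (b * x) ∈ RingHom.ker (εB.comp i) ^ 2 := by
    intro x hx
    refine Submodule.span_induction ?_ ?_ ?_ ?_ hx
    · rintro _ ⟨a, ha, rfl⟩ b
      rw [mul_comm b]
      have : tr (i a * b) ∈ RingHom.ker (εB.comp i) ^ 2 := by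
        rw [htrmul]
        exact Ideal.mul_mem_right _ _ ha
      exact this
    · intro b
      rw [mul_zero, htr0]
      exact Ideal.zero_mem _
    · intro x y _ _ hx hy b
      rw [mul_add, htradd]
      exact Ideal.add_mem _ (hx b) (hy b)
    · intro a x _ hx b
      rw [smul_eq_mul, ← mul_assoc]
      exact hx _
  obtain ⟨c, hc, hcr⟩ := hsq _ hr
  -- By linearity of the trace, `tr (z c r) = tr (z c) r`. The left side lies in the square of the
  -- maximal ideal downstairs by `htrmem`, while `tr (z c)` has the same nonzero value at the point
  -- as `c`.
  refine ⟨tr (zB * c), ?_, ?_⟩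
  · change ε (tr (zB * c)) ≠ 0
    rwa [htrε]
  · have := htrmem _ hcr zB
    rwa [← mul_assoc, mul_comm _ (i r), htrmul, mul_comm] at this

end Transfer

/-! ### Heights and dimensions in integral extensions -/

section IntegralDimension

variable {A S : Type*} [CommRing A] [CommRing S] [Algebra A S] [Algebra.IsIntegral A S]

/-- Incomparability: contraction of primes is strictly monotone along an integral extension. -/
theorem height_le_height_comap_of_isIntegral (P : Ideal S) [P.IsPrime] :
    P.height ≤ (P.comap (algebraMap A S)).height := by
  let f : PrimeSpectrum S → PrimeSpectrum A := PrimeSpectrum.comap (algebraMap A S)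
  have hf : StrictMono f := fun p q hpq => Ideal.IsIntegral.comap_lt_comap hpq
  have := Order.height_le_height_apply_of_strictMono f hf ⟨P, inferInstance⟩
  rwa [← PrimeSpectrum.height_eq_orderHeight, ← PrimeSpectrum.height_eq_orderHeight] at this

/-- Lying over at the bottom of a chain of primes, then going up along it. -/
theorem ringKrullDim_le_of_isIntegral_of_injective (h : Function.Injective (algebraMap A S)) :
    ringKrullDim A ≤ ringKrullDim S := by
  refine iSup_le fun l => ?_
  obtain ⟨Q, -, hQ, hQl⟩ := Ideal.exists_ideal_over_prime_of_isIntegral (S := S) l.head.asIdeal ⊥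
    (by rw [← RingHom.ker_eq_comap_bot, (RingHom.injective_iff_ker_eq_bot _).1 h]; exact bot_le)
  have : Q.LiesOver l.head.asIdeal := ⟨hQl.symm⟩
  obtain ⟨L, hL, -⟩ := Ideal.exists_ltSeries_of_hasGoingUp l Q
  rw [← hL]
  exact le_iSup (fun L : LTSeries (PrimeSpectrum S) => (L.length : WithBot ℕ∞)) L

end IntegralDimension

/-! ### Polynomial functions, points and translations -/

section CoordinateRing

variable {k : Type u} [Field k] {V : Type v} [AddCommGroup V] [Module k V]

/-- Evaluation of polynomial functions at a point. -/
def evalAt (v : V) : CoordRing k V →ₐ[k] k :=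
  SymmetricAlgebra.lift (Module.Dual.eval k V v)

@[simp]
theorem evalAt_ι (v : V) (l : Module.Dual k V) :
    evalAt v (SymmetricAlgebra.ι k (Module.Dual k V) l) = l v := by
  simp [evalAt]

theorem smul_ι (g : V ≃ₗ[k] V) (l : Module.Dual k V) :
    g • SymmetricAlgebra.ι k (Module.Dual k V) l =
      SymmetricAlgebra.ι k (Module.Dual k V) (l ∘ₗ ((g⁻¹ : V ≃ₗ[k] V) : V →ₗ[k] V)) :=
  coordAct_ι g l

theorem evalAt_smul (v : V) (g : V ≃ₗ[k] V) (f : CoordRing k V) :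
    evalAt v (g • f) = evalAt (g⁻¹ v) f := by
  have : (evalAt v).comp (coordAct g) = evalAt (g⁻¹ v) := by
    apply SymmetricAlgebra.algHom_ext
    ext l
    change evalAt v (coordAct g (SymmetricAlgebra.ι k _ l)) = evalAt _ (SymmetricAlgebra.ι k _ l)
    rw [coordAct_ι, evalAt_ι, evalAt_ι]
    rfl
  exact congrArg (fun φ => φ f) this

theorem evalAt_zero : evalAt (0 : V) = SymmetricAlgebra.algebraMapInv (R := k) := by
  apply SymmetricAlgebra.algHom_ext
  ext l
  change evalAt 0 (SymmetricAlgebra.ι k _ l) =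
    SymmetricAlgebra.algebraMapInv (SymmetricAlgebra.ι k _ l)
  rw [evalAt_ι, map_zero, SymmetricAlgebra.algebraMapInv_ι]

theorem evalAt_injective [FiniteDimensional k V] {v w : V}
    (h : ∀ l : Module.Dual k V, evalAt v (SymmetricAlgebra.ι k _ l) =
      evalAt w (SymmetricAlgebra.ι k _ l)) : v = w := by
  rw [← sub_eq_zero, ← Module.forall_dual_apply_eq_zero_iff k]
  intro l
  have := h l
  rw [evalAt_ι, evalAt_ι] at this
  rw [map_sub, this, sub_self]

theorem eq_of_ker_evalAt_eq [FiniteDimensional k V] {v w : V}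
    (h : RingHom.ker (evalAt (k := k) v) ≤ RingHom.ker (evalAt (k := k) w)) : v = w := by
  apply evalAt_injective (k := k)
  intro l
  have := h (sub_algebraMap_mem_ker (evalAt v) (SymmetricAlgebra.ι k _ l))
  rw [RingHom.mem_ker, map_sub, AlgHom.commutes, sub_eq_zero] at this
  exact this.symm

instance [FiniteDimensional k V] : FaithfulSMul (V ≃ₗ[k] V) (CoordRing k V) where
  eq_of_smul_eq_smul {g h} hgh := by
    rw [← inv_inj]
    ext v
    apply evalAt_injective (k := k)
    intro l
    rw [← evalAt_smul, ← evalAt_smul, hgh]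

variable (k V) in
/-- Coordinates identify `S(V*)` with a polynomial ring. -/
def coordRingEquiv [FiniteDimensional k V] :
    CoordRing k V ≃ₐ[k] MvPolynomial (Fin (Module.finrank k (Module.Dual k V))) k :=
  SymmetricAlgebra.equivMvPolynomial (Module.finBasis k (Module.Dual k V))

instance [FiniteDimensional k V] : IsNoetherianRing (CoordRing k V) :=
  isNoetherianRing_of_ringEquiv _ (coordRingEquiv k V).symm.toRingEquiv

instance [FiniteDimensional k V] : UniqueFactorizationMonoid (CoordRing k V) :=
  (coordRingEquiv k V).symm.toMulEquiv.uniqueFactorizationMonoid inferInstance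

instance [FiniteDimensional k V] : Algebra.FiniteType k (CoordRing k V) :=
  .equiv inferInstance (coordRingEquiv k V).symm

theorem ringKrullDim_coordRing [FiniteDimensional k V] :
    ringKrullDim (CoordRing k V) = Module.finrank k V := by
  rw [ringKrullDim_eq_of_ringEquiv (coordRingEquiv k V).toRingEquiv,
    MvPolynomial.ringKrullDim_of_isNoetherianRing, ringKrullDim_eq_zero_of_field]
  simp [Subspace.dual_finrank_eq]

/-- **Nullstellensatz**. -/
theorem exists_eq_ker_evalAt [IsAlgClosed k] [FiniteDimensional k V] (M : Ideal (CoordRing k V))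
    [M.IsMaximal] : ∃ v : V, M = RingHom.ker (evalAt (k := k) v) := by
  let F := CoordRing k V ⧸ M
  let _ : Field F := Ideal.Quotient.field M
  have hfin : Module.Finite k F := finite_of_finite_type_of_isJacobsonRing k F
  have hbij : Function.Bijective (algebraMap k F) :=
    IsAlgClosed.algebraMap_bijective_of_isIntegral
  let χ : CoordRing k V →ₐ[k] k :=
    ((AlgEquiv.ofBijective (Algebra.ofId k F) hbij).symm : F →ₐ[k] k).comp (Ideal.Quotient.mkₐ k M)
  -- The character restricted to linear forms is an element of the double dual, hence evaluation at
  -- a vector.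
  obtain ⟨v, hv⟩ := (Module.evalEquiv k V).surjective
    ((χ : CoordRing k V →ₗ[k] k) ∘ₗ SymmetricAlgebra.ι k _)
  refine ⟨v, ?_⟩
  have hχ : χ = evalAt v := by
    apply SymmetricAlgebra.algHom_ext
    ext l
    have := congrArg (fun φ => φ l) hv
    change χ (SymmetricAlgebra.ι k _ l) = evalAt v (SymmetricAlgebra.ι k _ l)
    rw [evalAt_ι]
    exact this.symm
  rw [← hχ]
  ext f
  change _ ↔ (AlgEquiv.ofBijective (Algebra.ofId k F) hbij).symm (Ideal.Quotient.mk M f) = 0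
  rw [EmbeddingLike.map_eq_zero_iff, Ideal.Quotient.eq_zero_iff_mem]

/-- Translation by a vector. -/
def translate (w : V) : CoordRing k V →ₐ[k] CoordRing k V :=
  SymmetricAlgebra.lift (SymmetricAlgebra.ι k (Module.Dual k V) +
    Algebra.linearMap k (CoordRing k V) ∘ₗ Module.Dual.eval k V w)

theorem translate_ι (w : V) (l : Module.Dual k V) :
    translate w (SymmetricAlgebra.ι k _ l) =
      SymmetricAlgebra.ι k _ l + algebraMap k (CoordRing k V) (l w) := by
  simp [translate]

theorem translate_comp_translate (w w' : V) :
    (translate w).comp (translate w') = translate (k := k) (w + w') := by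
  apply SymmetricAlgebra.algHom_ext
  ext l
  change translate w (translate w' (SymmetricAlgebra.ι k _ l)) =
    translate (w + w') (SymmetricAlgebra.ι k _ l)
  simp only [translate_ι, map_add, AlgHom.commutes, add_assoc]

theorem translate_zero : translate (0 : V) = AlgHom.id k (CoordRing k V) := by
  apply SymmetricAlgebra.algHom_ext
  ext l
  change translate 0 (SymmetricAlgebra.ι k _ l) = SymmetricAlgebra.ι k _ l
  simp [translate_ι]

/-- Translation as an automorphism. -/
def translateEquiv (w : V) : CoordRing k V ≃ₐ[k] CoordRing k V :=
  .ofAlgHom (translate w) (translate (-w))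
    (by rw [translate_comp_translate, add_neg_cancel, translate_zero])
    (by rw [translate_comp_translate, neg_add_cancel, translate_zero])

theorem evalAt_translate (v w : V) (f : CoordRing k V) :
    evalAt v (translate w f) = evalAt (v + w) f := by
  have : (evalAt v).comp (translate w) = evalAt (k := k) (v + w) := by
    apply SymmetricAlgebra.algHom_ext
    ext l
    change evalAt v (translate w (SymmetricAlgebra.ι k _ l)) =
      evalAt (v + w) (SymmetricAlgebra.ι k _ l)
    simp [translate_ι]
  exact congrArg (fun φ => φ f) this

theorem translate_smul {w : V} {g : V ≃ₗ[k] V} (hg : g w = w) (f : CoordRing k V) :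
    translate w (g • f) = g • translate w f := by
  have : (translate w).comp (coordAct g) = (coordAct g).comp (translate w) := by
    apply SymmetricAlgebra.algHom_ext
    ext l
    change translate w (coordAct g (SymmetricAlgebra.ι k _ l)) =
      coordAct g (translate w (SymmetricAlgebra.ι k _ l))
    rw [coordAct_ι, translate_ι, translate_ι, map_add, coordAct_ι, AlgHom.commutes]
    congr 2
    change l (g.symm w) = l w
    rw [← hg, LinearEquiv.symm_apply_apply, hg]
  exact congrArg (fun φ => φ f) this

/-- By translation all points have the same height, and by the Nullstellensatz they are all the
maximal ideals, so this height is the dimension of the ring. -/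
theorem height_ker_evalAt [IsAlgClosed k] [FiniteDimensional k V] (v : V) :
    (RingHom.ker (evalAt (k := k) v)).height = Module.finrank k V := by
  have htr : ∀ w : V, (RingHom.ker (evalAt (k := k) w)).height =
      (RingHom.ker (evalAt (k := k) v)).height := by
    intro w
    have : RingHom.ker (evalAt (k := k) w) =
        (RingHom.ker (evalAt (k := k) v)).comap (translateEquiv (k := k) (w - v)).toRingEquiv := by
      ext f
      rw [Ideal.mem_comap, RingHom.mem_ker, RingHom.mem_ker]
      change _ ↔ evalAt v (translate (w - v) f) = 0
      rw [evalAt_translate, add_sub_cancel]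
    rw [this]
    exact RingEquiv.height_comap (translateEquiv (w - v)).toRingEquiv _
  apply le_antisymm
  · have := Ideal.height_le_ringKrullDim_of_ne_top
      (RingHom.ker_ne_top (evalAt (k := k) v).toRingHom)
    rw [ringKrullDim_coordRing] at this
    exact WithBot.coe_le_coe.1 this
  · have := (ringKrullDim_le_iff_isMaximal_height_le (R := CoordRing k V)
      ((RingHom.ker (evalAt (k := k) v)).height)).2 (fun M hM => by
        obtain ⟨w, rfl⟩ := exists_eq_ker_evalAt M
        rw [htr])
    rw [ringKrullDim_coordRing] at this
    exact WithBot.coe_le_coe.1 this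

end CoordinateRing

/-! ### Points of quotients by finite groups -/

section EvaluationOnSubalgebras

variable {k : Type u} [Field k] {V : Type v} [AddCommGroup V] [Module k V]

/-- Evaluation at a point, restricted to a subalgebra of the coordinate ring. -/
abbrev evalOn (A : Subalgebra k (CoordRing k V)) (v : V) : A →ₐ[k] k :=
  (evalAt v).comp A.val

variable [IsAlgClosed k] [FiniteDimensional k V] (A : Subalgebra k (CoordRing k V))

/-- Above by the dimension of the integral overring, below by incomparability from the point `v`
upstairs; no going down is required. -/
theorem height_ker_evalOn [Algebra.IsIntegral A (CoordRing k V)] (v : V) :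
    (RingHom.ker (evalOn A v)).height = Module.finrank k V := by
  apply le_antisymm
  · have h₁ := Ideal.height_le_ringKrullDim_of_ne_top (RingHom.ker_ne_top (evalOn A v).toRingHom)
    have h₂ := ringKrullDim_le_of_isIntegral_of_injective (A := A) (S := CoordRing k V)
      Subtype.val_injective
    rw [ringKrullDim_coordRing] at h₂
    exact WithBot.coe_le_coe.1 (h₁.trans h₂)
  · rw [← height_ker_evalAt v]
    exact height_le_height_comap_of_isIntegral (A := A) (RingHom.ker (evalAt (k := k) v))

theorem exists_eq_ker_evalOn [Algebra.IsIntegral A (CoordRing k V)] (M : Ideal A) [M.IsMaximal] :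
    ∃ v : V, M = RingHom.ker (evalOn A v) := by
  obtain ⟨Q, hQ, rfl⟩ := Ideal.exists_ideal_over_maximal_of_isIntegral (S := CoordRing k V) M
    (by rw [(RingHom.injective_iff_ker_eq_bot _).1 Subtype.val_injective]; exact bot_le)
  obtain ⟨v, rfl⟩ := exists_eq_ker_evalAt Q
  exact ⟨v, rfl⟩

theorem isRegularLocalRing_localization_ker_evalOn_iff [IsNoetherianRing A]
    [Algebra.IsIntegral A (CoordRing k V)] (v : V) :
    IsRegularLocalRing (Localization.AtPrime (RingHom.ker (evalOn A v))) ↔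
      Module.finrank k (RingHom.ker (evalOn A v)).Cotangent = Module.finrank k V := by
  rw [isRegularLocalRing_localization_iff, height_ker_evalOn, Nat.cast_inj]

end EvaluationOnSubalgebras

section FiniteGroups

variable {k : Type u} [Field k] {V : Type v} [AddCommGroup V] [Module k V]
variable {Γ : Type*} [Group Γ] [Finite Γ] [MulSemiringAction Γ (CoordRing k V)]
  [SMulCommClass Γ k (CoordRing k V)]

instance : Algebra.IsInvariant (Invariants k V Γ) (CoordRing k V) Γ where
  isInvariant x hx := ⟨⟨x, hx⟩, rfl⟩

instance : Algebra.IsIntegral (Invariants k V Γ) (CoordRing k V) :=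
  Algebra.IsInvariant.isIntegral _ _ Γ

/-- The Artin–Tate argument, since the coordinate ring is finite over the invariants. -/
instance [FiniteDimensional k V] : Algebra.FiniteType k (Invariants k V Γ) := by
  have : Algebra.FiniteType (Invariants k V Γ) (CoordRing k V) := .of_restrictScalars_finiteType k _ _
  have : Module.Finite (Invariants k V Γ) (CoordRing k V) := Algebra.IsIntegral.finite
  exact ⟨fg_of_fg_of_fg k (Invariants k V Γ) (CoordRing k V) Algebra.FiniteType.out
    Module.Finite.fg_top Subtype.val_injective⟩

instance [FiniteDimensional k V] : IsNoetherianRing (Invariants k V Γ) :=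
  Algebra.FiniteType.isNoetherianRing k _

/-- Invariant functions separate orbits. -/
theorem exists_smul_eq_of_ker_evalOn_eq [FiniteDimensional k V] [MulAction Γ V]
    (hΓ : ∀ (g : Γ) (v : V) (f : CoordRing k V), evalAt v (g • f) = evalAt (g⁻¹ • v) f) {v w : V}
    (h : RingHom.ker (evalOn (Invariants k V Γ) v) = RingHom.ker (evalOn (Invariants k V Γ) w)) :
    ∃ g : Γ, g • v = w := by
  obtain ⟨g, hg⟩ := Algebra.IsInvariant.exists_smul_of_under_eq (Invariants k V Γ)
    (CoordRing k V) Γ (RingHom.ker (evalAt (k := k) v)) (RingHom.ker (evalAt (k := k) w)) h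
  refine ⟨g, (eq_of_ker_evalAt_eq (k := k) fun f hf => ?_).symm⟩
  rw [hg] at hf
  rw [Ideal.mem_pointwise_smul_iff_inv_smul_mem, RingHom.mem_ker, hΓ, inv_inv] at hf
  exact hf

end FiniteGroups

/-! ### Interpolation and passage to the stabilizer of a vector -/

section Interpolation

variable {k : Type u} [Field k] {V : Type v} [AddCommGroup V] [Module k V]

theorem exists_evalAt_eq_one_eq_zero [FiniteDimensional k V] (s : Set V) (hs : s.Finite) (w : V) (hw : w ∉ s) :
    ∃ f : CoordRing k V, evalAt w f = 1 ∧ ∀ v ∈ s, evalAt v f = 0 := by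
  induction s, hs using Set.Finite.induction_on with
  | empty => exact ⟨1, map_one _, by simp⟩
  | @insert a s ha hs ih =>
    obtain ⟨f, hf, hf'⟩ := ih fun h => hw (Set.mem_insert_of_mem _ h)
    have hwa : w - a ≠ 0 := fun h => hw (by rw [sub_eq_zero.1 h]; exact Set.mem_insert _ _)
    obtain ⟨l, hl⟩ := not_forall.1 (mt (Module.forall_dual_apply_eq_zero_iff k (w - a)).1 hwa)
    refine ⟨f * (algebraMap k _ (l (w - a))⁻¹ *
      (SymmetricAlgebra.ι k _ l - algebraMap k _ (l a))), ?_, ?_⟩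
    · rw [map_mul, hf, one_mul, map_mul, AlgHom.commutes, map_sub (evalAt w), AlgHom.commutes, evalAt_ι]
      change (l (w - a))⁻¹ * (l w - l a) = 1
      rw [← map_sub]
      exact inv_mul_cancel₀ hl
    · rintro v (rfl | hv)
      · simp
      · rw [map_mul, hf' v hv, zero_mul]

end Interpolation

section Restriction

variable {k : Type u} [Field k] {V : Type v} [AddCommGroup V] [Module k V]
  {G : Subgroup (V ≃ₗ[k] V)}

theorem evalAt_smul_subgroup (g : G) (v : V) (f : CoordRing k V) :
    evalAt v (g • f) = evalAt (g⁻¹ • v) f :=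
  evalAt_smul v g.1 f

theorem evalAt_smul_subgroup_subgroup {H : Subgroup G} (g : H) (v : V) (f : CoordRing k V) :
    evalAt v (g • f) = evalAt (g⁻¹ • v) f :=
  evalAt_smul v g.1.1 f

end Restriction

section Transfer

variable {k : Type u} [Field k] {V : Type v} [AddCommGroup V] [Module k V]
  [FiniteDimensional k V] {G : Subgroup (V ≃ₗ[k] V)} [Finite G]

/-- The stabilizer is the inertia group at `w`, so passing from its quotient to that of `G` does not
change the tangent space at `w`. -/
theorem finrank_cotangent_stabilizer_eq (w : V) :
    Module.finrank k (RingHom.ker (evalOn (Invariants k V G) w)).Cotangent =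
      Module.finrank k
        (RingHom.ker (evalOn (Invariants k V (MulAction.stabilizer G w)) w)).Cotangent := by
  have : Fintype (MulAction.stabilizer G w) := Fintype.ofFinite _
  obtain ⟨f, hf, hf'⟩ := exists_evalAt_eq_one_eq_zero (k := k) (MulAction.orbit G w \ {w})
    ((Set.finite_range _).subset Set.sdiff_subset) w (by simp)
  -- The function `f` is 1 at `w` and 0 on the rest of its orbit; the product over the stabilizer
  -- makes it invariant and keeps these values.
  apply finrank_cotangent_invariants_eq (evalAt w) (MulAction.stabilizer G w)
    (z := ∏ h : MulAction.stabilizer G w, h • f)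
  · intro h hh
    exact Finset.smul_prod_perm f (⟨h, hh⟩ : MulAction.stabilizer G w)
  · rw [map_prod]
    refine Finset.prod_eq_one fun h _ => ?_
    change evalAt w ((h : G) • f) = 1
    rw [evalAt_smul_subgroup, inv_smul_eq_iff.2 h.2.symm, hf]
  · intro g hg
    rw [Finset.smul_prod', map_prod]
    refine Finset.prod_eq_zero (Finset.mem_univ 1) ?_
    rw [one_smul, evalAt_smul_subgroup]
    refine hf' _ ⟨⟨g⁻¹, rfl⟩, fun h => hg ?_⟩
    exact (inv_smul_eq_iff.1 h).symm

end Transfer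

/-! ### The grading of the coordinate ring -/

section Grading

open _root_.Polynomial

variable {k : Type u} [Field k] {V : Type v} [AddCommGroup V] [Module k V]

variable (k V) in
/-- The dilation `ℓ ↦ ℓ X` of the coordinate ring, whose coefficients are the projections onto the
homogeneous components. -/
def dilation : CoordRing k V →ₐ[k] (CoordRing k V)[X] :=
  SymmetricAlgebra.lift
    ((Polynomial.monomial 1).restrictScalars k ∘ₗ SymmetricAlgebra.ι k (Module.Dual k V))

theorem dilation_ι (l : Module.Dual k V) :
    dilation k V (SymmetricAlgebra.ι k _ l) = monomial 1 (SymmetricAlgebra.ι k _ l) := by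
  simp [dilation]

/-- The homogeneous component of degree `d` of a polynomial function. -/
def homogeneousPart (d : ℕ) : CoordRing k V →ₗ[k] CoordRing k V :=
  (Polynomial.lcoeff (CoordRing k V) d).restrictScalars k ∘ₗ (dilation k V).toLinearMap

theorem homogeneousPart_apply (d : ℕ) (f : CoordRing k V) :
    homogeneousPart d f = (dilation k V f).coeff d :=
  rfl

/-- Homogeneous polynomial functions of degree `d`. -/
def IsHomogeneousFun (f : CoordRing k V) (d : ℕ) : Prop :=
  dilation k V f = monomial d f

theorem IsHomogeneousFun.mul {f g : CoordRing k V} {d e : ℕ} (hf : IsHomogeneousFun f d)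
    (hg : IsHomogeneousFun g e) : IsHomogeneousFun (f * g) (d + e) := by
  rw [IsHomogeneousFun, map_mul, hf, hg, monomial_mul_monomial]

theorem IsHomogeneousFun.homogeneousPart_of_ne {f : CoordRing k V} {d e : ℕ}
    (hf : IsHomogeneousFun f d) (h : d ≠ e) : homogeneousPart e f = 0 := by
  rw [homogeneousPart_apply, hf, coeff_monomial_of_ne _ h.symm]

theorem IsHomogeneousFun.homogeneousPart_eq {f : CoordRing k V} {d : ℕ}
    (hf : IsHomogeneousFun f d) : homogeneousPart d f = f := by
  rw [homogeneousPart_apply, hf, coeff_monomial_same]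

theorem isHomogeneousFun_zero (d : ℕ) : IsHomogeneousFun (0 : CoordRing k V) d := by
  simp [IsHomogeneousFun]

theorem IsHomogeneousFun.add {f g : CoordRing k V} {d : ℕ} (hf : IsHomogeneousFun f d)
    (hg : IsHomogeneousFun g d) : IsHomogeneousFun (f + g) d := by
  rw [IsHomogeneousFun, map_add, hf, hg, map_add]

theorem isHomogeneousFun_sum {α : Type*} (s : Finset α) {f : α → CoordRing k V} {d : ℕ}
    (hf : ∀ i ∈ s, IsHomogeneousFun (f i) d) : IsHomogeneousFun (∑ i ∈ s, f i) d := by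
  rw [IsHomogeneousFun, map_sum, map_sum]
  exact Finset.sum_congr rfl hf

theorem isHomogeneousFun_algebraMap (c : k) :
    IsHomogeneousFun (algebraMap k (CoordRing k V) c) 0 := by
  rw [IsHomogeneousFun, AlgHom.commutes]
  rfl

theorem isHomogeneousFun_ι (l : Module.Dual k V) :
    IsHomogeneousFun (SymmetricAlgebra.ι k (Module.Dual k V) l) 1 :=
  dilation_ι l

theorem homogeneousPart_mul (d : ℕ) (f g : CoordRing k V) :
    homogeneousPart d (f * g) =
      ∑ x ∈ Finset.HasAntidiagonal.antidiagonal d, homogeneousPart x.1 f * homogeneousPart x.2 g := by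
  rw [homogeneousPart_apply, map_mul, coeff_mul]
  rfl

theorem isHomogeneousFun_homogeneousPart (d : ℕ) (f : CoordRing k V) :
    IsHomogeneousFun (homogeneousPart d f) d := by
  induction f using SymmetricAlgebra.induction generalizing d with
  | algebraMap c =>
    by_cases h : 0 = d
    · subst h
      rw [(isHomogeneousFun_algebraMap c).homogeneousPart_eq]
      exact isHomogeneousFun_algebraMap c
    · rw [(isHomogeneousFun_algebraMap c).homogeneousPart_of_ne h]
      exact isHomogeneousFun_zero d
  | ι l =>
    by_cases h : 1 = d
    · subst h
      rw [(isHomogeneousFun_ι l).homogeneousPart_eq]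
      exact isHomogeneousFun_ι l
    · rw [(isHomogeneousFun_ι l).homogeneousPart_of_ne h]
      exact isHomogeneousFun_zero d
  | add f g hf hg =>
    rw [map_add]
    exact (hf d).add (hg d)
  | mul f g hf hg =>
    rw [homogeneousPart_mul]
    refine isHomogeneousFun_sum _ fun x hx => ?_
    rw [← Finset.HasAntidiagonal.mem_antidiagonal.1 hx]
    exact (hf _).mul (hg _)

theorem sum_homogeneousPart (f : CoordRing k V) :
    ∑ d ∈ (dilation k V f).support, homogeneousPart d f = f := by
  have h : ((Polynomial.aeval (1 : CoordRing k V)).restrictScalars k).comp (dilation k V) =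
      AlgHom.id k _ := by
    apply SymmetricAlgebra.algHom_ext
    ext l
    change Polynomial.aeval 1 (dilation k V (SymmetricAlgebra.ι k _ l)) = SymmetricAlgebra.ι k _ l
    rw [dilation_ι, Polynomial.aeval_monomial, one_pow, mul_one]
    rfl
  have h' : Polynomial.eval 1 (dilation k V f) = f := congrArg (fun φ => φ f) h
  rw [Polynomial.eval_eq_sum, Polynomial.sum] at h'
  simp only [one_pow, mul_one] at h'
  exact h'

theorem homogeneousPart_zero (f : CoordRing k V) :
    homogeneousPart 0 f = algebraMap k _ (evalAt 0 f) := by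
  have h : (Polynomial.constantCoeff.comp (dilation k V).toRingHom) =
      ((Algebra.ofId k (CoordRing k V)).comp (evalAt (0 : V))).toRingHom := by
    let φ : CoordRing k V →ₐ[k] CoordRing k V :=
      { Polynomial.constantCoeff.comp (dilation k V).toRingHom with
        commutes' c := by simp }
    have : φ = (Algebra.ofId k (CoordRing k V)).comp (evalAt (0 : V)) := by
      apply SymmetricAlgebra.algHom_ext
      ext l
      change Polynomial.constantCoeff (dilation k V (SymmetricAlgebra.ι k _ l)) =
        algebraMap k _ (evalAt (0 : V) (SymmetricAlgebra.ι k _ l))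
      rw [dilation_ι, evalAt_ι, map_zero, map_zero]
      simp
    exact congrArg AlgHom.toRingHom this
  exact congrArg (fun φ => φ f) h

theorem IsHomogeneousFun.evalAt_zero {f : CoordRing k V} {d : ℕ} (hf : IsHomogeneousFun f d)
    (hd : d ≠ 0) : evalAt 0 f = 0 := by
  have := hf.homogeneousPart_of_ne hd
  rw [homogeneousPart_zero] at this
  exact (FaithfulSMul.algebraMap_eq_zero_iff k _).1 this

theorem homogeneousPart_smul (g : V ≃ₗ[k] V) (d : ℕ) (f : CoordRing k V) :
    homogeneousPart d (g • f) = g • homogeneousPart d f := by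
  have h : (dilation k V).comp (coordAct g) =
      (Polynomial.mapAlgHom (coordAct g)).comp (dilation k V) := by
    apply SymmetricAlgebra.algHom_ext
    ext l : 1
    change dilation k V (coordAct g (SymmetricAlgebra.ι k _ l)) =
      Polynomial.map (coordAct g).toRingHom (dilation k V (SymmetricAlgebra.ι k _ l))
    rw [coordAct_ι, dilation_ι, dilation_ι, Polynomial.map_monomial]
    congr 1
    exact (coordAct_ι g l).symm
  have h' : dilation k V (g • f) = Polynomial.map (coordAct g).toRingHom (dilation k V f) :=
    congrArg (fun φ => φ f) h
  rw [homogeneousPart_apply, h', Polynomial.coeff_map]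
  rfl

/-- A subalgebra of the coordinate ring is graded if it contains the homogeneous components of its
elements. -/
def IsGradedSubalgebra (A : Subalgebra k (CoordRing k V)) : Prop :=
  ∀ d : ℕ, ∀ f ∈ A, homogeneousPart d f ∈ A

variable {A : Subalgebra k (CoordRing k V)}

/-- Without constant terms both factors contribute positive degrees, hence degrees below `d`. This
lets arguments about the square of the maximal ideal proceed by degree. -/
theorem homogeneousPart_mul_of_evalAt_zero (d : ℕ) {f g : CoordRing k V} (hf : evalAt 0 f = 0)
    (hg : evalAt 0 g = 0) :
    homogeneousPart d (f * g) = ∑ x ∈ Finset.HasAntidiagonal.antidiagonal d with x.1 < d ∧ x.2 < d,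
      homogeneousPart x.1 f * homogeneousPart x.2 g := by
  rw [homogeneousPart_mul, Finset.sum_filter_of_ne]
  intro x hx hne
  have h₁ : x.1 ≠ 0 := fun h => hne (by rw [h, homogeneousPart_zero, hf, map_zero, zero_mul])
  have h₂ : x.2 ≠ 0 := fun h => hne (by rw [h, homogeneousPart_zero, hg, map_zero, mul_zero])
  have := Finset.HasAntidiagonal.mem_antidiagonal.1 hx
  omega

/-- Homogeneous elements spanning the cotangent space at the origin generate the algebra. -/
theorem adjoin_eq_top_of_span_eq_top (hA : IsGradedSubalgebra A)
    (T : Set A) (hT : ∀ f ∈ T, ∃ d ≠ 0, IsHomogeneousFun (f : CoordRing k V) d)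
    (hspan : ∀ f ∈ RingHom.ker (evalOn A 0),
      ∃ c ∈ Submodule.span k T, f - c ∈ RingHom.ker (evalOn A 0) ^ 2) :
    Algebra.adjoin k T = ⊤ := by
  -- Graded Nakayama: a homogeneous element is a combination of `T` modulo the square of the maximal
  -- ideal, whose degree `d` part is built from components of smaller degree.
  have key : ∀ d : ℕ, ∀ f : A, ∀ h : homogeneousPart d (f : CoordRing k V) ∈ A,
      (⟨homogeneousPart d (f : CoordRing k V), h⟩ : A) ∈ Algebra.adjoin k T := by
    intro d
    induction d using Nat.strong_induction_on with
    | _ d ih =>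
      have hsq : ∀ r ∈ RingHom.ker (evalOn A 0) ^ 2,
          (⟨homogeneousPart d (r : CoordRing k V), hA d r r.2⟩ : A) ∈ Algebra.adjoin k T := by
        intro r hr
        rw [pow_two] at hr
        refine Submodule.mul_induction_on hr (fun f hf g hg => ?_) (fun f g hf hg => ?_)
        · have : (⟨homogeneousPart d ((f * g : A) : CoordRing k V), hA d _ (f * g).2⟩ : A) =
              ∑ x ∈ Finset.HasAntidiagonal.antidiagonal d with x.1 < d ∧ x.2 < d,
                (⟨homogeneousPart x.1 (f : CoordRing k V), hA _ _ f.2⟩ : A) *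
                ⟨homogeneousPart x.2 (g : CoordRing k V), hA _ _ g.2⟩ := by
            apply Subtype.ext
            rw [AddSubmonoidClass.coe_finsetSum]
            exact homogeneousPart_mul_of_evalAt_zero d hf hg
          rw [this]
          refine sum_mem fun x hx => mul_mem (ih _ ?_ _ _) (ih _ ?_ _ _)
          · exact (Finset.mem_filter.1 hx).2.1
          · exact (Finset.mem_filter.1 hx).2.2
        · convert add_mem hf hg
          exact map_add _ _ _
      have hc : ∀ c ∈ Submodule.span k T,
          (⟨homogeneousPart d (c : CoordRing k V), hA d c c.2⟩ : A) ∈ Algebra.adjoin k T := by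
        intro c hc
        induction hc using Submodule.span_induction with
        | mem c hc =>
          obtain ⟨e, -, he⟩ := hT c hc
          by_cases h : e = d
          · subst h
            have : (⟨homogeneousPart e (c : CoordRing k V), hA e c c.2⟩ : A) = c :=
              Subtype.ext he.homogeneousPart_eq
            rw [this]
            exact Algebra.subset_adjoin hc
          · convert zero_mem (Algebra.adjoin k T)
            exact he.homogeneousPart_of_ne h
        | zero =>
          convert zero_mem (Algebra.adjoin k T)
          exact map_zero _
        | add f g _ _ hf hg =>
          convert add_mem hf hg
          exact map_add _ _ _
        | smul a f _ hf =>
          convert Subalgebra.smul_mem _ hf a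
          exact map_smul _ _ _
      intro f h
      rcases Nat.eq_zero_or_pos d with rfl | hd
      · convert Subalgebra.algebraMap_mem (Algebra.adjoin k T) (evalAt 0 (f : CoordRing k V))
        exact homogeneousPart_zero _
      · have hf₀ : (⟨homogeneousPart d (f : CoordRing k V), h⟩ : A) ∈ RingHom.ker (evalOn A 0) :=
          (isHomogeneousFun_homogeneousPart d (f : CoordRing k V)).evalAt_zero hd.ne'
        obtain ⟨c, hcT, hr⟩ := hspan _ hf₀
        convert add_mem (hc c hcT) (hsq _ hr)
        change homogeneousPart d (f : CoordRing k V) = homogeneousPart d (c : CoordRing k V) +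
          homogeneousPart d (homogeneousPart d (f : CoordRing k V) - (c : CoordRing k V))
        rw [← map_add, add_sub_cancel,
          (isHomogeneousFun_homogeneousPart d (f : CoordRing k V)).homogeneousPart_eq]
  refine eq_top_iff.2 fun f _ => ?_
  have : f = ∑ d ∈ (dilation k V (f : CoordRing k V)).support,
      (⟨homogeneousPart d (f : CoordRing k V), hA d f f.2⟩ : A) := by
    apply Subtype.ext
    rw [AddSubmonoidClass.coe_finsetSum]
    exact (sum_homogeneousPart _).symm
  rw [this]
  exact sum_mem fun d _ => key d f _

end Grading

/-! ### Homogeneous generators and a criterion for polynomial rings -/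

section CotangentSpace

variable {k : Type*} [Field k] {A : Type*} [CommRing A] [Algebra k A]

theorem smul_cotangent_eq (ε : A →ₐ[k] k) (a : A) (x : (RingHom.ker ε).Cotangent) :
    a • x = ε a • x := by
  have h := Ideal.Cotangent.smul_eq_zero_of_mem (sub_algebraMap_mem_ker ε a) x
  rwa [sub_smul, algebraMap_smul, sub_eq_zero] at h

/-- `A` acts on the cotangent space through `ε`, so generators over `A` also span over `k`. -/
theorem finite_cotangent_ker [IsNoetherianRing A] (ε : A →ₐ[k] k) :
    Module.Finite k (RingHom.ker ε).Cotangent := by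
  have : Module.Finite A (RingHom.ker ε).Cotangent :=
    Module.Finite.of_surjective _ (RingHom.ker ε).toCotangent_surjective
  obtain ⟨s, hs⟩ := this.fg_top
  refine ⟨⟨s, eq_top_iff.2 fun x _ => ?_⟩⟩
  have hx : x ∈ Submodule.span A (s : Set (RingHom.ker ε).Cotangent) := hs ▸ Submodule.mem_top
  induction hx using Submodule.span_induction with
  | mem x hx => exact Submodule.subset_span hx
  | zero => exact zero_mem _
  | add x y _ _ hx hy => exact add_mem (hx trivial) (hy trivial)
  | smul a x _ hx =>
    rw [smul_cotangent_eq]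
    exact Submodule.smul_mem _ _ (hx trivial)

theorem IsPolynomialRing.isRegularRing (h : IsPolynomialRing k A) : IsRegularRing A := by
  obtain ⟨n, ⟨e⟩⟩ := h
  exact IsRegularRing.of_ringEquiv e.symm.toRingEquiv

end CotangentSpace

section Generators

variable {k : Type u} [Field k] {V : Type v} [AddCommGroup V] [Module k V]
  {A : Subalgebra k (CoordRing k V)}

/-- The classes of homogeneous elements in the cotangent space at the origin. -/
def homogeneousCotangent (A : Subalgebra k (CoordRing k V)) :
    Set (RingHom.ker (evalOn A 0)).Cotangent :=
  {x | ∃ f : RingHom.ker (evalOn A 0), (∃ d ≠ 0, IsHomogeneousFun ((f : A) : CoordRing k V) d) ∧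
    (RingHom.ker (evalOn A 0)).toCotangent f = x}

theorem span_homogeneousCotangent (hA : IsGradedSubalgebra A) :
    Submodule.span k (homogeneousCotangent A) = ⊤ := by
  refine eq_top_iff.2 fun x _ => ?_
  obtain ⟨f, rfl⟩ := Ideal.toCotangent_surjective _ x
  have h₀ : ∀ d ∈ (dilation k V ((f : A) : CoordRing k V)).support, d ≠ 0 := by
    rintro d hd rfl
    rw [Polynomial.mem_support_iff, ← homogeneousPart_apply, homogeneousPart_zero] at hd
    have : evalAt 0 ((f : A) : CoordRing k V) = 0 := f.2
    rw [this, map_zero] at hd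
    exact hd rfl
  let F : (dilation k V ((f : A) : CoordRing k V)).support → RingHom.ker (evalOn A 0) := fun d =>
    ⟨⟨homogeneousPart d ((f : A) : CoordRing k V), hA _ _ (f : A).2⟩,
      (isHomogeneousFun_homogeneousPart d.1 ((f : A) : CoordRing k V)).evalAt_zero (h₀ d d.2)⟩
  have hF : f = ∑ d, F d := by
    apply Subtype.ext
    apply Subtype.ext
    rw [AddSubmonoidClass.coe_finsetSum, AddSubmonoidClass.coe_finsetSum]
    rw [Finset.sum_coe_sort (dilation k V ((f : A) : CoordRing k V)).support
      fun d => homogeneousPart d ((f : A) : CoordRing k V), sum_homogeneousPart]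
  rw [hF, map_sum]
  exact sum_mem fun d _ => Submodule.subset_span ⟨F d, ⟨d, h₀ d d.2,
    isHomogeneousFun_homogeneousPart d.1 ((f : A) : CoordRing k V)⟩, rfl⟩

theorem adjoin_range_eq_top (hA : IsGradedSubalgebra A) {ι : Type*}
    (b : Module.Basis ι k (RingHom.ker (evalOn A 0)).Cotangent)
    (F : ι → RingHom.ker (evalOn A 0))
    (hF : ∀ i, ∃ d ≠ 0, IsHomogeneousFun ((F i : A) : CoordRing k V) d)
    (hFb : ∀ i, (RingHom.ker (evalOn A 0)).toCotangent (F i) = b i) :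
    Algebra.adjoin k (Set.range fun i => (F i : A)) = ⊤ := by
  apply adjoin_eq_top_of_span_eq_top hA
  · rintro _ ⟨i, rfl⟩
    exact hF i
  · intro f hf
    let π : RingHom.ker (evalOn A 0) →ₗ[k] (RingHom.ker (evalOn A 0)).Cotangent :=
      (RingHom.ker (evalOn A 0)).toCotangent.restrictScalars k
    have hx : π ⟨f, hf⟩ ∈ (Submodule.span k (Set.range F)).map π := by
      rw [Submodule.map_span, ← Set.range_comp]
      have : π ∘ F = b := funext hFb
      rw [this, b.span_eq]
      trivial
    obtain ⟨c, hc, hcf⟩ := hx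
    refine ⟨c, ?_, (Ideal.toCotangent_eq _).1 hcf.symm⟩
    have : (c : A) ∈ (Submodule.span k (Set.range F)).map
      ((RingHom.ker (evalOn A 0)).subtype.restrictScalars k) := ⟨c, hc, rfl⟩
    rwa [Submodule.map_span, ← Set.range_comp] at this

/-- A homogeneous function whose class in the cotangent space is nonzero extends to a minimal system
of generators. -/
theorem exists_generators_of_notMem_sq [IsNoetherianRing A] (hA : IsGradedSubalgebra A)
    (f : RingHom.ker (evalOn A 0)) {d : ℕ} (hd : d ≠ 0)
    (hfd : IsHomogeneousFun ((f : A) : CoordRing k V) d)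
    (hf : (f : A) ∉ RingHom.ker (evalOn A 0) ^ 2) :
    ∃ T : Finset A, T.card + 1 = Module.finrank k (RingHom.ker (evalOn A 0)).Cotangent ∧
      (∀ g ∈ T, g ∈ RingHom.ker (evalOn A 0)) ∧
      Algebra.adjoin k (insert (f : A) (T : Set A)) = ⊤ := by
  classical
  have := finite_cotangent_ker (evalOn A 0)
  let x := (RingHom.ker (evalOn A 0)).toCotangent f
  have hx : x ≠ 0 := fun h => hf ((Ideal.toCotangent_eq_zero _ f).1 h)
  have hli : LinearIndepOn k id ({x} : Set (RingHom.ker (evalOn A 0)).Cotangent) :=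
    LinearIndepOn.singleton hx
  have hst : ({x} : Set (RingHom.ker (evalOn A 0)).Cotangent) ⊆ homogeneousCotangent A :=
    Set.singleton_subset_iff.2 ⟨f, ⟨d, hd, hfd⟩, rfl⟩
  let b := Module.Basis.extendLe hli hst (span_homogeneousCotangent hA).ge
  have hfin : Finite (hli.extend hst) := Module.Finite.finite_basis b
  let _ : Fintype (hli.extend hst) := Fintype.ofFinite _
  choose F hF hFb using fun i : hli.extend hst => hli.extend_subset hst i.2
  let i₀ : hli.extend hst := ⟨x, hli.subset_extend hst rfl⟩
  have hgen := adjoin_range_eq_top hA b (Function.update F i₀ f)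
    (fun i => by
      by_cases h : i = i₀
      · subst h
        rw [Function.update_self]
        exact ⟨d, hd, hfd⟩
      · rw [Function.update_of_ne h]
        exact hF i)
    (fun i => by
      rw [Module.Basis.extendLe_apply_self]
      by_cases h : i = i₀
      · subst h
        rw [Function.update_self]
      · rw [Function.update_of_ne h]
        exact hFb i)
  refine ⟨(Finset.univ.erase i₀).image fun i => (F i : A), ?_, ?_, ?_⟩
  · rw [Finset.card_image_of_injective, Finset.card_erase_add_one (Finset.mem_univ _),
      Finset.card_univ, Module.finrank_eq_card_basis b]
    intro i j hij
    apply Subtype.ext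
    rw [← hFb i, ← hFb j]
    exact congrArg _ (Subtype.ext hij)
  · intro g hg
    obtain ⟨i, -, rfl⟩ := Finset.mem_image.1 hg
    exact (F i).2
  · rw [eq_top_iff, ← hgen]
    apply Algebra.adjoin_mono
    rintro _ ⟨i, rfl⟩
    by_cases h : i = i₀
    · subst h
      change ((Function.update F i₀ f i₀ : RingHom.ker (evalOn A 0)) : A) ∈ _
      rw [Function.update_self]
      exact Set.mem_insert _ _
    · change ((Function.update F i₀ f i : RingHom.ker (evalOn A 0)) : A) ∈ _
      rw [Function.update_of_ne h]
      exact Set.mem_insert_of_mem _ (Finset.mem_coe.2 (Finset.mem_image_of_mem _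
        (Finset.mem_erase.2 ⟨h, Finset.mem_univ _⟩)))

variable [IsAlgClosed k] [FiniteDimensional k V]

/-- A graded subalgebra over which the coordinate ring is integral is a polynomial ring as soon as
its cotangent space at the origin has the right dimension. -/
theorem isPolynomialRing_of_finrank_cotangent [IsNoetherianRing A]
    [Algebra.IsIntegral A (CoordRing k V)] (hA : IsGradedSubalgebra A)
    (h : Module.finrank k (RingHom.ker (evalOn A 0)).Cotangent = Module.finrank k V) :
    IsPolynomialRing k A := by
  have := finite_cotangent_ker (evalOn A 0)
  let b := Module.Basis.ofSpan (span_homogeneousCotangent hA).ge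
  have hfin := Module.Finite.finite_basis b
  let ι := ((linearIndepOn_empty k id).extend (Set.empty_subset (homogeneousCotangent A)))
  let _ : Fintype ι := Fintype.ofFinite _
  choose F hF hFb using fun i : ι =>
    (linearIndepOn_empty k id).extend_subset (Set.empty_subset (homogeneousCotangent A)) i.2
  have hgen := adjoin_range_eq_top hA b F hF
    (fun i => by rw [hFb, Module.Basis.ofSpan_apply_self])
  let φ : MvPolynomial ι k →ₐ[k] A := MvPolynomial.aeval fun i => (F i : A)
  have hsurj : Function.Surjective φ := by
    rw [← AlgHom.range_eq_top, ← Algebra.adjoin_range_eq_range_aeval, hgen]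
  have hcard : Fintype.card ι = Module.finrank k V := by
    rw [← h, Module.finrank_eq_card_basis b]
  have hdim : (Module.finrank k V : WithBot ℕ∞) ≤ ringKrullDim A := by
    have := Ideal.height_le_ringKrullDim_of_ne_top (RingHom.ker_ne_top (evalOn A 0).toRingHom)
    change ((RingHom.ker (evalOn A 0)).height : WithBot ℕ∞) ≤ _ at this
    rwa [height_ker_evalOn] at this
  -- A relation among the `dim V` generators would drop the dimension of `A` below `dim V`, the
  -- height of the origin.
  have hinj : Function.Injective φ := by
    refine (injective_iff_map_eq_zero φ).2 fun r hr => ?_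
    by_contra hr₀
    have h₁ := ringKrullDim_succ_le_of_surjective (φ : MvPolynomial ι k →+* A) hsurj
      (mem_nonZeroDivisors_of_ne_zero hr₀) hr
    rw [MvPolynomial.ringKrullDim_of_isNoetherianRing, ringKrullDim_eq_zero_of_field,
      Nat.card_eq_fintype_card, hcard, zero_add] at h₁
    have h₂ : (Module.finrank k V : WithBot ℕ∞) + 1 ≤ Module.finrank k V :=
      (add_le_add_left hdim 1).trans h₁
    have h₃ : Module.finrank k V + 1 ≤ Module.finrank k V := by exact_mod_cast h₂
    omega
  exact ⟨Fintype.card ι, ⟨(AlgEquiv.ofBijective φ ⟨hinj, hsurj⟩).symm.trans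
    (MvPolynomial.renameEquiv k (Fintype.equivFin ι))⟩⟩

/-- A polynomial ring is regular at every point, and each point has height `dim V`. -/
theorem IsPolynomialRing.finrank_cotangent [IsNoetherianRing A]
    [Algebra.IsIntegral A (CoordRing k V)] (h : IsPolynomialRing k A) (v : V) :
    Module.finrank k (RingHom.ker (evalOn A v)).Cotangent = Module.finrank k V := by
  exact (isRegularLocalRing_localization_ker_evalOn_iff A v).1
    (h.isRegularRing.isRegularLocalRing_localization _)

end Generators

/-! ### Linear forms, inertia and pseudoreflections -/

section LinearForms

variable {k : Type u} [Field k] {V : Type v} [AddCommGroup V] [Module k V]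

theorem exists_algebraMap_eq_of_natDegree_dilation_eq_zero {f : CoordRing k V}
    (hf : (dilation k V f).natDegree = 0) : ∃ c, algebraMap k (CoordRing k V) c = f := by
  refine ⟨evalAt 0 f, ?_⟩
  have h := sum_homogeneousPart f
  rw [← homogeneousPart_zero]
  rw [Polynomial.eq_C_of_natDegree_eq_zero hf] at h
  by_cases h₀ : (dilation k V f).coeff 0 = 0
  · rw [h₀, map_zero, Polynomial.support_zero, Finset.sum_empty] at h
    rw [← h, map_zero]
  · rw [Polynomial.support_C h₀, Finset.sum_singleton] at h
    exact h

/-- Evaluating the coefficients of the dilation at `w` gives the restriction of `f` to the line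
through `w`, as a polynomial in one variable. -/
theorem eval_map_dilation (c : k) (w : V) (f : CoordRing k V) :
    ((dilation k V f).map (evalAt w).toRingHom).eval c = evalAt (c • w) f := by
  have h : ((Polynomial.aeval c).comp (Polynomial.mapAlgHom (evalAt w))).comp (dilation k V) =
      evalAt (c • w) := by
    apply SymmetricAlgebra.algHom_ext
    ext l
    change Polynomial.eval c ((dilation k V (SymmetricAlgebra.ι k _ l)).map
      (evalAt w).toRingHom) = evalAt (c • w) (SymmetricAlgebra.ι k _ l)
    rw [dilation_ι, Polynomial.map_monomial, Polynomial.eval_monomial, evalAt_ι, map_smul,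
      pow_one, smul_eq_mul, mul_comm]
    exact congrArg _ (evalAt_ι w l)
  exact congrArg (fun φ => φ f) h

theorem ι_injective : Function.Injective (SymmetricAlgebra.ι k (Module.Dual k V)) := by
  intro l l' h
  ext v
  rw [← evalAt_ι, h, evalAt_ι]

variable [FiniteDimensional k V]

/-- The degree is additive and elements of degree 0 are scalars, so a nonunit factor takes all of
the degree 1 and its cofactor is a unit. -/
theorem dvd_of_dvd_ι {q : CoordRing k V} (hq : ¬ IsUnit q) {l : Module.Dual k V} (hl : l ≠ 0)
    (h : q ∣ SymmetricAlgebra.ι k _ l) : SymmetricAlgebra.ι k _ l ∣ q := by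
  obtain ⟨c, hc⟩ := h
  have hl' : SymmetricAlgebra.ι k (Module.Dual k V) l ≠ 0 := by
    rwa [Ne, map_eq_zero_iff _ ι_injective]
  have hq₀ : dilation k V q ≠ 0 := by
    intro h₀
    have := sum_homogeneousPart q
    rw [h₀, Polynomial.support_zero, Finset.sum_empty] at this
    rw [← this, zero_mul] at hc
    exact hl' hc
  have hc₀ : dilation k V c ≠ 0 := by
    intro h₀
    have := sum_homogeneousPart c
    rw [h₀, Polynomial.support_zero, Finset.sum_empty] at this
    rw [← this, mul_zero] at hc
    exact hl' hc
  have hdeg : (dilation k V q).natDegree + (dilation k V c).natDegree = 1 := by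
    rw [← Polynomial.natDegree_mul hq₀ hc₀, ← map_mul, ← hc, dilation_ι,
      Polynomial.natDegree_monomial_eq _ hl']
  have hunit : ∀ f : CoordRing k V, dilation k V f ≠ 0 → (dilation k V f).natDegree = 0 →
      IsUnit f := by
    intro f hf₀ hf
    obtain ⟨a, rfl⟩ := exists_algebraMap_eq_of_natDegree_dilation_eq_zero hf
    refine (IsUnit.mk0 a ?_).map _
    rintro rfl
    exact hf₀ (by rw [map_zero, map_zero])
  have hqdeg : (dilation k V q).natDegree ≠ 0 := fun h => hq (hunit q hq₀ h)
  have hcu : IsUnit c := hunit c hc₀ (by omega)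
  rw [hc]
  exact (IsUnit.mul_right_dvd hcu).2 dvd_rfl

/-- A nontrivial element of the inertia group of a prime divisor is a pseudoreflection. -/
theorem isPseudoreflection_of_dvd {q : CoordRing k V} (hq : ¬ IsUnit q) {g : V ≃ₗ[k] V}
    (hg : IsOfFinOrder g) (hg₁ : g ≠ 1) (h : ∀ f : CoordRing k V, q ∣ g • f - f) :
    IsPseudoreflection g := by
  refine ⟨hg, ?_⟩
  have hdual : ∀ l : Module.Dual k V, q ∣ SymmetricAlgebra.ι k _
      (l ∘ₗ ((g⁻¹ : V ≃ₗ[k] V) : V →ₗ[k] V) - l) := by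
    intro l
    rw [map_sub, ← smul_ι]
    exact h _
  obtain ⟨l, hl⟩ : ∃ l : Module.Dual k V,
      l ∘ₗ ((g⁻¹ : V ≃ₗ[k] V) : V →ₗ[k] V) - l ≠ 0 := by
    by_contra! hcon
    refine hg₁ (inv_eq_one.1 ?_)
    ext v
    apply evalAt_injective (k := k)
    intro l
    rw [evalAt_ι, evalAt_ι]
    exact LinearMap.congr_fun (sub_eq_zero.1 (hcon l)) v
  set l₀ := l ∘ₗ ((g⁻¹ : V ≃ₗ[k] V) : V →ₗ[k] V) - l with hl₀
  -- The form `l₀` divides `q`, hence every difference of a form and its translate by `g`; all of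
  -- these vanish on the hyperplane `l₀ = 0`.
  have hker : LinearMap.ker l₀ ≤ (g : V →ₗ[k] V).fixedSubmodule := by
    intro v hv
    rw [LinearMap.mem_fixedSubmodule_iff]
    have hv' : g⁻¹ v = v := by
      apply evalAt_injective (k := k)
      intro m
      rw [evalAt_ι, evalAt_ι]
      obtain ⟨c, hc⟩ := (dvd_of_dvd_ι hq hl (hdual l)).trans (hdual m)
      have := congrArg (evalAt v) hc
      rw [map_mul, evalAt_ι, evalAt_ι, LinearMap.mem_ker.1 hv, zero_mul] at this
      exact sub_eq_zero.1 this
    change g v = v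
    nth_rw 1 [← hv']
    exact LinearEquiv.apply_symm_apply g v
  have hco : IsCoatom (LinearMap.ker l₀) := LinearMap.isCoatom_ker_of_surjective (LinearMap.surjective hl)
  rcases hco.le_iff.1 hker with h' | h'
  · refine absurd ?_ hg₁
    ext v
    exact (LinearMap.mem_fixedSubmodule_iff.1 (h' ▸ Submodule.mem_top : v ∈ _))
  · rw [h']
    exact hco

/-- **Serre's theorem**: a group with a polynomial ring of invariants is generated by
pseudoreflections. -/
theorem pseudoreflectionSubgroup_eq_top [IsAlgClosed k] {G : Subgroup (V ≃ₗ[k] V)} [Finite G]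
    (h : IsPolynomialRing k (Invariants k V G)) : pseudoreflectionSubgroup G = ⊤ := by
  have : Infinite k := IsAlgClosed.instInfinite
  refine eq_top_of_isPolynomialRing (evalAt (0 : V)) (fun g s => ?_) _ (fun q hq g hg => ?_) h
  · rw [evalAt_smul_subgroup, smul_zero]
  · by_cases hg₁ : g = 1
    · rw [hg₁]
      exact one_mem _
    · refine Subgroup.subset_closure (isPseudoreflection_of_dvd hq.not_isUnit ?_ ?_ hg)
      · exact G.subtype.isOfFinOrder (isOfFinOrder_of_finite g)
      · exact fun h => hg₁ (Subtype.ext h)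

end LinearForms

/-! ### Moving a fixed vector to the origin; generic vectors of a subspace -/

section Translation

variable {k : Type u} [Field k] {V : Type v} [AddCommGroup V] [Module k V]
  {G : Subgroup (V ≃ₗ[k] V)} {H : Subgroup G}

/-- Translation by a vector fixed by `H` commutes with `H`, so it induces an automorphism of the
invariants carrying one point to the other. -/
theorem finrank_cotangent_translate {w : V} (hw : ∀ h ∈ H, h • w = w) :
    Module.finrank k (RingHom.ker (evalOn (Invariants k V H) w)).Cotangent =
      Module.finrank k (RingHom.ker (evalOn (Invariants k V H) 0)).Cotangent := by
  have hmem : ∀ w : V, (∀ h ∈ H, h • w = w) → ∀ f ∈ Invariants k V H,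
      translate w f ∈ Invariants k V H := by
    intro w hw f hf h
    change (h : V ≃ₗ[k] V) • translate w f = translate w f
    rw [← translate_smul (hw h h.2)]
    exact congrArg _ (hf h)
  let φ : Invariants k V H →ₐ[k] Invariants k V H :=
    ((translate w).comp (Invariants k V H).val).codRestrict _ fun f => hmem w hw f f.2
  let ψ : Invariants k V H →ₐ[k] Invariants k V H :=
    ((translate (-w)).comp (Invariants k V H).val).codRestrict _ fun f =>
      hmem (-w) (fun h hh => by rw [smul_neg, hw h hh]) f f.2
  have hφψ : ∀ f, φ (ψ f) = f := fun f =>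
    Subtype.ext ((translateEquiv w).apply_symm_apply (f : CoordRing k V))
  have hψφ : ∀ f, ψ (φ f) = f := fun f =>
    Subtype.ext ((translateEquiv w).symm_apply_apply (f : CoordRing k V))
  have hcomp : (evalOn (Invariants k V H) 0).comp φ = evalOn (Invariants k V H) w := by
    ext f
    change evalAt 0 (translate w (f : CoordRing k V)) = evalAt w (f : CoordRing k V)
    rw [evalAt_translate, zero_add]
  have key := finrank_cotangent_eq φ (evalOn (Invariants k V H) 0) (fun r hr => ?_) fun b hb => ?_
  · rwa [hcomp] at key
  · refine ⟨1, by rw [map_one, map_one]; exact one_ne_zero, ?_⟩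
    rw [one_mul]
    have h₁ : ψ (φ r) ∈ ((RingHom.ker (evalOn (Invariants k V H) 0)) ^ 2).map ψ :=
      Ideal.mem_map_of_mem _ hr
    rw [hψφ, Ideal.map_pow] at h₁
    refine Ideal.pow_right_mono (Ideal.map_le_iff_le_comap.2 fun f hf => ?_) 2 h₁
    rw [Ideal.mem_comap, RingHom.mem_ker]
    change evalOn (Invariants k V H) 0 (φ (ψ f)) = 0
    rw [hφψ]
    exact hf
  · refine ⟨1, by rw [map_one]; exact one_ne_zero, ?_⟩
    rw [one_mul, ← hφψ b]
    refine Ideal.mem_map_of_mem _ ?_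
    rw [RingHom.mem_ker]
    change evalOn (Invariants k V H) 0 (φ (ψ b)) = 0
    rw [hφψ]
    exact hb

end Translation

section GenericPoints

variable {k : Type u} [Field k] [Infinite k] {V : Type v} [AddCommGroup V] [Module k V]
  {G : Subgroup (V ≃ₗ[k] V)} [Finite G]

/-- A nonzero subspace contains a vector whose stabilizer is the pointwise stabilizer of the
subspace and at which a given function that does not vanish at the origin does not vanish. -/
theorem exists_stabilizer_eq_fixingSubgroup {W : Submodule k V} (hW : W ≠ ⊥) {f : CoordRing k V}
    (hf : evalAt 0 f ≠ 0) : ∃ w ∈ W, w ≠ 0 ∧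
      MulAction.stabilizer G w = fixingSubgroup G (W : Set V) ∧ evalAt w f ≠ 0 := by
  obtain ⟨w, hwW, hw₀, hw⟩ : ∃ w ∈ W, w ≠ 0 ∧ ∀ g : G, g • w = w → ∀ x ∈ W, g • x = x := by
    by_contra! hcon
    -- Proper subspaces of `W`: the zero subspace, indexed by `none`, and the fixed spaces in `W` of
    -- the elements acting nontrivially on `W`.
    let p : Option {g : G // ∃ x ∈ W, g • x ≠ x} → Submodule k W := fun
      | none => ⊥
      | some g => ((g.1 : V ≃ₗ[k] V) : V →ₗ[k] V).fixedSubmodule.comap W.subtype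
    have hp : ⋃ i, (p i : Set W) = Set.univ := by
      refine Set.eq_univ_of_forall fun w => Set.mem_iUnion.2 ?_
      by_cases hw₀ : (w : V) = 0
      · exact ⟨none, Subtype.ext hw₀⟩
      · obtain ⟨g, hg, x, hx, hgx⟩ := hcon w w.2 hw₀
        refine ⟨some ⟨g, x, hx, hgx⟩, ?_⟩
        exact LinearMap.mem_fixedSubmodule_iff.2 hg
    obtain ⟨i, hi⟩ := Subspace.exists_eq_top_of_iUnion_eq_univ hp
    match i with
    | none =>
      refine hW (eq_bot_iff.2 fun x hx => ?_)
      have : (⟨x, hx⟩ : W) ∈ (⊥ : Submodule k W) := (show (⊥ : Submodule k W) = ⊤ from hi) ▸ Submodule.mem_top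
      exact congrArg Subtype.val ((Submodule.mem_bot k).1 this)
    | some ⟨g, x, hx, hgx⟩ =>
      refine hgx ?_
      have : (⟨x, hx⟩ : W) ∈ p (some ⟨g, x, hx, hgx⟩) := hi ▸ Submodule.mem_top
      exact LinearMap.mem_fixedSubmodule_iff.1 this
  -- A multiple `c • w` is sought with `f` nonzero on it. The restriction of `f` to the line is
  -- nonzero at 0, and the factor `X` excludes `c = 0`.
  have hP : (Polynomial.X * (dilation k V f).map (evalAt w).toRingHom) ≠ 0 := by
    refine mul_ne_zero Polynomial.X_ne_zero fun h => hf ?_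
    have := congrArg (fun P => Polynomial.coeff P 0) h
    simp only [Polynomial.coeff_map, ← homogeneousPart_apply, homogeneousPart_zero,
      Polynomial.coeff_zero] at this
    exact ((evalAt w).commutes _).symm.trans this
  obtain ⟨c, hc⟩ : ∃ c, Polynomial.eval c
      (Polynomial.X * (dilation k V f).map (evalAt w).toRingHom) ≠ 0 := by
    by_contra! hcon
    exact hP (Polynomial.funext fun c => by rw [hcon, Polynomial.eval_zero])
  rw [Polynomial.eval_mul, Polynomial.eval_X, eval_map_dilation] at hc
  have hc₀ := left_ne_zero_of_mul hc
  refine ⟨c • w, W.smul_mem c hwW, smul_ne_zero hc₀ hw₀, ?_, right_ne_zero_of_mul hc⟩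
  ext g
  rw [MulAction.mem_stabilizer_iff, mem_fixingSubgroup_iff]
  constructor
  · intro hg
    refine hw g (smul_right_injective V hc₀ ?_)
    change c • g • w = c • w
    rw [smul_comm]
    exact hg
  · exact fun hg => hg _ (W.smul_mem c hwW)

end GenericPoints

/-! ### Elements of order `p` and the index of the reflection subgroup -/

section Unipotent

/-- An automorphism of order `p` in characteristic `p` fixes a nonzero vector in every stable set
with a nonzero vector. -/
theorem exists_ne_zero_apply_eq_self {k M : Type*} [Field k] [AddCommGroup M] [Module k M] (p : ℕ)
    [Fact p.Prime] [CharP k p] (σ : Module.End k M) (hσ : σ ^ p = 1) {s : Set M}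
    (hs : ∀ x ∈ s, σ x - x ∈ s) {x : M} (hx : x ∈ s) (hx₀ : x ≠ 0) :
    ∃ y ∈ s, y ≠ 0 ∧ σ y = y := by
  -- In characteristic `p` this is `σ ^ p - 1`. The last nonzero iterate of `σ - 1` on `x` is then
  -- fixed by `σ`.
  have hpow : (σ - 1) ^ p = 0 := by
    have : Nontrivial M := ⟨x, 0, hx₀⟩
    have : CharP (Module.End k M) p :=
      charP_of_injective_algebraMap (algebraMap k (Module.End k M)).injective p
    rw [sub_pow_char_of_commute _ (Commute.one_right σ), hσ, one_pow, sub_self]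
  have hex : ∃ n : ℕ, ((σ - 1) ^ n) x = 0 := ⟨p, by rw [hpow]; rfl⟩
  classical
  have hfind := Nat.find_spec hex
  have hpos : Nat.find hex ≠ 0 := by
    intro h
    rw [h] at hfind
    exact hx₀ hfind
  obtain ⟨n, hn⟩ := Nat.exists_eq_succ_of_ne_zero hpos
  refine ⟨((σ - 1) ^ n) x, ?_, Nat.find_min hex (by omega), ?_⟩
  · clear hn
    induction n with
    | zero => exact hx
    | succ n ih =>
      rw [pow_succ', Module.End.mul_apply]
      exact hs _ ih
  · rw [hn, Nat.succ_eq_add_one, pow_succ', Module.End.mul_apply] at hfind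
    exact sub_eq_zero.1 hfind

end Unipotent

section GradedInvariants

variable {k : Type u} [Field k] {V : Type v} [AddCommGroup V] [Module k V]
  {G : Subgroup (V ≃ₗ[k] V)}

theorem isGradedSubalgebra_invariants (H : Subgroup G) :
    IsGradedSubalgebra (Invariants k V H) := fun d f hf h => by
  change ((h : G) : V ≃ₗ[k] V) • homogeneousPart d f = homogeneousPart d f
  rw [← homogeneousPart_smul]
  exact congrArg _ (hf h)

theorem isGradedSubalgebra_invariants' : IsGradedSubalgebra (Invariants k V G) :=
  fun d f hf h => by
  change (h : V ≃ₗ[k] V) • homogeneousPart d f = homogeneousPart d f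
  rw [← homogeneousPart_smul]
  exact congrArg _ (hf h)

end GradedInvariants

section Order

variable {k : Type u} [Field k] [IsAlgClosed k] {V : Type v} [AddCommGroup V] [Module k V]
  [FiniteDimensional k V] {G : Subgroup (V ≃ₗ[k] V)}

variable [Finite G]

/-- A normal subgroup containing the stabilizers of all nonzero vectors and such that `V/H` is
regular at the origin has index prime to the characteristic. -/
theorem not_dvd_card_quotient (p : ℕ) [CharP k p] (H : Subgroup G) [H.Normal]
    (hH : ∀ (g : G) (v : V), v ≠ 0 → g • v = v → g ∈ H)
    (hreg : Module.finrank k (RingHom.ker (evalOn (Invariants k V H) 0)).Cotangent =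
      Module.finrank k V) :
    ¬ p ∣ Nat.card (G ⧸ H) := by
  intro hdvd
  have hp : p.Prime := by
    refine (CharP.char_is_prime_or_zero k p).resolve_right fun h₀ => ?_
    rw [h₀, zero_dvd_iff] at hdvd
    exact Nat.card_pos.ne' hdvd
  have : Fact p.Prime := ⟨hp⟩
  obtain ⟨σ, hσ⟩ := exists_prime_orderOf_dvd_card' p hdvd
  obtain ⟨g, rfl⟩ := QuotientGroup.mk_surjective σ
  have hgH : g ∉ H := fun h => by
    rw [(QuotientGroup.eq_one_iff g).2 h, orderOf_one] at hσ
    exact hp.one_lt.ne hσ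
  set A := Invariants k V H
  have hA : IsGradedSubalgebra A := isGradedSubalgebra_invariants H
  let m : Ideal A := RingHom.ker (evalOn A 0)
  -- the action of the chosen element on invariants
  let τ : A →ₐ[k] A := MulSemiringAction.toAlgHom k A (g : G ⧸ H)
  have hτpart : ∀ d (a : A), homogeneousPart d ((τ a : A) : CoordRing k V) =
      g • homogeneousPart d (a : CoordRing k V) := fun d a => homogeneousPart_smul (g : V ≃ₗ[k] V) d _
  have hheight : m.height = Module.finrank k V := height_ker_evalOn A 0
  -- an invariant of minimal positive degree that is fixed and not decomposable
  obtain ⟨f, d, hd, hfd, hf, hτf⟩ : ∃ (f : m) (d : ℕ), d ≠ 0 ∧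
      IsHomogeneousFun ((f : A) : CoordRing k V) d ∧ (f : A) ∉ m ^ 2 ∧ τ f = f := by
    -- Otherwise the maximal ideal is zero, of height 0, so `V = 0` and `G` is trivial, which leaves
    -- no element outside `H`.
    have hex : ∃ d, d ≠ 0 ∧ ∃ f : A, f ≠ 0 ∧ IsHomogeneousFun (f : CoordRing k V) d := by
      by_contra! hcon
      have hm : m = ⊥ := by
        refine eq_bot_iff.2 fun f hf => ?_
        rw [Ideal.mem_bot]
        by_contra hf₀
        refine hf₀ (Subtype.ext ?_)
        rw [← sum_homogeneousPart (f : CoordRing k V)]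
        refine Finset.sum_eq_zero fun d _ => ?_
        by_cases hd : d = 0
        · subst hd
          rw [homogeneousPart_zero, show evalAt 0 (f : CoordRing k V) = 0 from hf, map_zero]
        · by_contra hne
          exact hcon d hd ⟨homogeneousPart d (f : CoordRing k V), hA d f f.2⟩
            (fun h => hne (congrArg Subtype.val h)) (isHomogeneousFun_homogeneousPart d _)
      rw [hm, Ideal.height_bot] at hheight
      have hV : Subsingleton V := Module.finrank_zero_iff.1 (by exact_mod_cast hheight.symm)
      refine hgH ?_
      have : g = 1 := Subtype.ext (LinearEquiv.ext fun v => Subsingleton.elim _ _)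
      rw [this]
      exact one_mem H
    classical
    obtain ⟨hd, f₀, hf₀, hfd₀⟩ := Nat.find_spec hex
    have hmin : ∀ e < Nat.find hex, ∀ f ∈ m, homogeneousPart e (f : CoordRing k V) = 0 := by
      intro e he f hf
      by_cases he₀ : e = 0
      · subst he₀
        rw [homogeneousPart_zero, show evalAt 0 (f : CoordRing k V) = 0 from hf, map_zero]
      · by_contra hne
        exact Nat.find_min hex he ⟨he₀, ⟨homogeneousPart e (f : CoordRing k V), hA e f f.2⟩,
          fun h => hne (congrArg Subtype.val h), isHomogeneousFun_homogeneousPart e _⟩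
    set d := Nat.find hex
    have hτp : τ.toLinearMap ^ p = 1 := by
      have : ∀ n : ℕ, ∀ a, (τ.toLinearMap ^ n) a = ((g : G ⧸ H) ^ n) • a := by
        intro n
        induction n with
        | zero =>
          intro a
          rw [pow_zero, pow_zero, one_smul]
          rfl
        | succ n ih =>
          intro a
          rw [pow_succ', pow_succ', Module.End.mul_apply, ih, mul_smul]
          rfl
      ext a : 1
      rw [this, ← hσ, pow_orderOf_eq_one, one_smul]
      rfl
    obtain ⟨f, hfd, hf₀, hτf⟩ := exists_ne_zero_apply_eq_self (k := k) p τ.toLinearMap hτp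
      (s := {f : A | IsHomogeneousFun (f : CoordRing k V) d}) (fun f hf => by
        have h : homogeneousPart d ((τ f - f : A) : CoordRing k V) = (τ f - f : A) := by
          change homogeneousPart d (((τ f : A) : CoordRing k V) - (f : CoordRing k V)) = _
          rw [map_sub, hτpart, IsHomogeneousFun.homogeneousPart_eq hf]
          rfl
        change IsHomogeneousFun ((τ f - f : A) : CoordRing k V) d
        rw [← h]
        exact isHomogeneousFun_homogeneousPart d _) hfd₀ hf₀
    refine ⟨⟨f, IsHomogeneousFun.evalAt_zero hfd hd⟩, d, hd, hfd, fun hsq => hf₀ ?_, hτf⟩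
    -- Since `d` is the least positive degree of an invariant, products of two elements of `m` have
    -- no component of degree `d`.
    have hpart : ∀ r ∈ m ^ 2, homogeneousPart d (r : CoordRing k V) = 0 := by
      intro r hr
      rw [pow_two] at hr
      refine Submodule.mul_induction_on hr (fun a ha b hb => ?_) (fun a b ha hb => ?_)
      · change homogeneousPart d ((a : CoordRing k V) * (b : CoordRing k V)) = 0
        rw [homogeneousPart_mul_of_evalAt_zero d (show evalAt 0 (a : CoordRing k V) = 0 from ha)
          (show evalAt 0 (b : CoordRing k V) = 0 from hb)]
        refine Finset.sum_eq_zero fun x hx => ?_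
        rw [hmin x.1 (Finset.mem_filter.1 hx).2.1 a ha, zero_mul]
      · change homogeneousPart d ((a : CoordRing k V) + (b : CoordRing k V)) = 0
        rw [map_add, ha, hb, add_zero]
    apply Subtype.ext
    rw [← IsHomogeneousFun.homogeneousPart_eq hfd]
    exact hpart f hsq
  obtain ⟨T, hTcard, hTm, hTgen⟩ := exists_generators_of_notMem_sq hA f hd hfd hf
  classical
  -- The ideal of the fixed locus of `τ`. It is generated by the differences on algebra generators,
  -- and the generator `f` contributes nothing, which leaves at most `dim V - 1` equations.
  let T' : Finset A := T.image fun t => τ t - t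
  let J : Ideal A := Ideal.span (T' : Set A)
  have hJ : ∀ a, τ a - a ∈ J := by
    have halg : (Ideal.Quotient.mkₐ k J).comp τ = Ideal.Quotient.mkₐ k J := by
      refine AlgHom.ext_of_adjoin_eq_top hTgen ?_
      rintro t (rfl | ht)
      · exact congrArg (Ideal.Quotient.mkₐ k J) hτf
      · refine (Ideal.Quotient.eq).2 (Ideal.subset_span ?_)
        exact Finset.mem_coe.2 (Finset.mem_image_of_mem _ ht)
    exact fun a => Ideal.Quotient.eq.1 (congrArg (fun φ => φ a) halg)
  have hτm : ∀ a ∈ m, τ a ∈ m := by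
    intro a ha
    change evalAt 0 (g • (a : CoordRing k V)) = 0
    rw [evalAt_smul_subgroup, smul_zero]
    exact ha
  have hJm : J ≤ m := by
    refine Ideal.span_le.2 fun a ha => ?_
    obtain ⟨t, ht, rfl⟩ := Finset.mem_image.1 (Finset.mem_coe.1 ha)
    exact m.sub_mem (hτm t (hTm t ht)) (hTm t ht)
  -- At a zero `v` of `J`, the vectors `v` and `g⁻¹ v` lie in one `H`-orbit, so `g h` fixes `v` for
  -- some `h ∈ H`. For `v ≠ 0` this puts `g h`, hence `g`, in `H`.
  have hmax : ∀ M : Ideal A, M.IsMaximal → J ≤ M → M = m := by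
    intro M hM hJM
    obtain ⟨v, rfl⟩ := exists_eq_ker_evalOn A M
    suffices v = 0 by rw [this]
    obtain ⟨h, hh⟩ := exists_smul_eq_of_ker_evalOn_eq (Γ := H) (v := v) (w := g⁻¹ • v)
      evalAt_smul_subgroup_subgroup (by
        ext a
        have := hJM (hJ a)
        rw [RingHom.mem_ker, map_sub, sub_eq_zero] at this
        rw [RingHom.mem_ker, RingHom.mem_ker, ← this]
        change evalAt v (g • (a : CoordRing k V)) = 0 ↔ _
        rw [evalAt_smul_subgroup]
        rfl)
    by_contra hv
    have hgh : g * (h : G) ∈ H := by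
      refine hH _ v hv ?_
      rw [mul_smul]
      change g • (h • v) = v
      rw [hh, smul_inv_smul]
    exact hgH ((H.mul_mem_cancel_right h.2).1 hgh)
  -- In a Jacobson ring a prime above `J` is the intersection of the maximal ideals above it, and
  -- `m` is the only one. Krull's height theorem then bounds the height of `m` by the number of
  -- equations.
  have hmin : m ∈ J.minimalPrimes := by
    refine ⟨⟨inferInstance, hJm⟩, fun P hP _ => ?_⟩
    have : IsJacobsonRing A := isJacobsonRing_of_finiteType (A := k)
    have hPrad := this.out hP.1.isRadical
    rw [← hPrad]
    refine le_sInf fun M hM => ?_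
    rw [hmax M hM.2 (hP.2.trans hM.1)]
  have := Ideal.height_le_card_of_mem_minimalPrimes_span_finset hmin
  rw [hheight, ← hreg, ← hTcard] at this
  have h₁ : T.card + 1 ≤ T'.card := by exact_mod_cast this
  have h₂ : T'.card ≤ T.card := Finset.card_image_le
  omega

end Order

/-! ### Regular points of quotient varieties and quotients in stages -/

section RegularPoints

theorem isRegularPoint_Spec_iff {R : Type u} [CommRing R] (x : PrimeSpectrum R) :
    IsRegularPoint (Spec (CommRingCat.of R)) x ↔
      IsRegularLocalRing (Localization.AtPrime x.asIdeal) := by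
  let e := (Spec.stalkIso (CommRingCat.of R) x).commRingCatIsoToRingEquiv
  exact ⟨fun h => @IsRegularLocalRing.of_ringEquiv _ _ h _ _ e,
    fun h => @IsRegularLocalRing.of_ringEquiv _ _ h _ _ e.symm⟩

theorem isNonsingular_Spec {R : Type u} [CommRing R] [IsRegularRing R] :
    IsNonsingular (Spec (CommRingCat.of R)) := fun x =>
  by
  let y : PrimeSpectrum R := x
  exact (isRegularPoint_Spec_iff y).2 (IsRegularRing.isRegularLocalRing_localization _)

variable {k : Type u} [Field k] {V : Type v} [AddCommGroup V] [Module k V]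
  {Γ : Type*} [Group Γ] [MulSemiringAction Γ (CoordRing k V)] [SMulCommClass Γ k (CoordRing k V)]

variable (k Γ) in
/-- The image in the quotient variety of a vector. -/
def quotientPoint (w : V) : quotientVariety k V Γ :=
  (⟨RingHom.ker (evalOn (Invariants k V Γ) w), RingHom.ker_isPrime _⟩ :
    PrimeSpectrum (Invariants k V Γ))

theorem quotientProj_origin : quotientProj k V Γ (origin k V) = quotientPoint k Γ 0 := by
  refine PrimeSpectrum.ext ?_
  change (RingHom.ker (SymmetricAlgebra.algebraMapInv (R := k) (M := Module.Dual k V))).comap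
    (Invariants k V Γ).val.toRingHom = RingHom.ker (evalOn (Invariants k V Γ) 0)
  rw [← evalAt_zero]
  rfl

theorem isClosed_quotientPoint (w : V) : IsClosed {quotientPoint k Γ w} :=
  (PrimeSpectrum.isClosed_singleton_iff_isMaximal _).2
    (inferInstanceAs (RingHom.ker (evalOn (Invariants k V Γ) w)).IsMaximal)

variable [IsAlgClosed k] [FiniteDimensional k V] [Finite Γ]

theorem isRegularPoint_quotientPoint_iff (w : V) :
    IsRegularPoint (quotientVariety k V Γ) (quotientPoint k Γ w) ↔
      Module.finrank k (RingHom.ker (evalOn (Invariants k V Γ) w)).Cotangent =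
        Module.finrank k V := by
  rw [← isRegularLocalRing_localization_ker_evalOn_iff]
  exact isRegularPoint_Spec_iff (R := Invariants k V Γ) _

theorem exists_eq_quotientPoint (x : quotientVariety k V Γ) (hx : IsClosed {x}) :
    ∃ w : V, x = quotientPoint k Γ w := by
  have := (PrimeSpectrum.isClosed_singleton_iff_isMaximal x).1 hx
  obtain ⟨w, hw⟩ := exists_eq_ker_evalOn (Invariants k V Γ) x.asIdeal
  exact ⟨w, PrimeSpectrum.ext hw⟩

end RegularPoints

section QuotientInStages

variable {k : Type u} [Field k] {V : Type v} [AddCommGroup V] [Module k V]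
  (G : Subgroup (V ≃ₗ[k] V)) (H : Subgroup G) [H.Normal]

/-- Invariants of `G` are the invariants of `G/H` on the invariants of `H`. -/
def iteratedInvariantsEquiv :
    FixedPoints.subalgebra k (Invariants k V H) (G ⧸ H) ≃+* Invariants k V G where
  toFun f := ⟨f.1.1, fun g => congrArg Subtype.val (f.2 (g : G ⧸ H))⟩
  invFun f := ⟨⟨f.1, fun h => f.2 h⟩, fun g => by
    obtain ⟨g, rfl⟩ := QuotientGroup.mk_surjective g
    exact Subtype.ext (f.2 g)⟩
  left_inv _ := rfl
  right_inv _ := rfl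
  map_mul' _ _ := rfl
  map_add' _ _ := rfl

theorem exists_iso_iteratedQuotient :
    ∃ e : quotientVariety k V G ≅ iteratedQuotient G H,
      quotientProj k V G ≫ e.hom = quotientProj k V H ≫ iteratedQuotientProj G H := by
  refine ⟨Scheme.Spec.mapIso (iteratedInvariantsEquiv G H).toCommRingCatIso.op, ?_⟩
  change Spec.map _ ≫ Spec.map _ = Spec.map _ ≫ Spec.map _
  rw [← Spec.map_comp, ← Spec.map_comp]
  rfl

end QuotientInStages

/-! ### Pointwise stabilizers and reflection subgroups -/

section Stabilizers

variable {k : Type u} [Field k] {V : Type v} [AddCommGroup V] [Module k V]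
  {G : Subgroup (V ≃ₗ[k] V)}

theorem fixingSubgroup_span_singleton (w : V) :
    fixingSubgroup G ((k ∙ w : Submodule k V) : Set V) = MulAction.stabilizer G w := by
  ext g
  rw [MulAction.mem_stabilizer_iff, mem_fixingSubgroup_iff]
  refine ⟨fun hg => hg w (Submodule.mem_span_singleton_self w), fun hg y hy => ?_⟩
  obtain ⟨c, rfl⟩ := Submodule.mem_span_singleton.1 hy
  rw [smul_comm, hg]

/-- Allows results about subgroups of `GL(V)` to be applied to a subgroup of `G`. -/
theorem invariants_map_subtype (H : Subgroup G) :
    Invariants k V (H.map G.subtype) = Invariants k V H := by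
  ext f
  refine ⟨fun hf h => hf ⟨_, h, h.2, rfl⟩, ?_⟩
  rintro hf ⟨_, h, hh, rfl⟩
  exact hf ⟨h, hh⟩

theorem le_pseudoreflectionSubgroup {H : Subgroup G}
    (hH : pseudoreflectionSubgroup (H.map G.subtype) = ⊤) : H ≤ pseudoreflectionSubgroup G := by
  have hle : pseudoreflectionSubgroup (H.map G.subtype) ≤ (pseudoreflectionSubgroup G).comap
      (Subgroup.inclusion (Subgroup.map_subtype_le H)) :=
    (Subgroup.closure_le _).2 fun g hg => Subgroup.subset_closure hg
  rw [hH] at hle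
  exact fun h hh => hle (x := ⟨h, h, hh, rfl⟩) trivial

variable (G) in
theorem pseudoreflectionSubgroup_map_pseudoreflectionSubgroup :
    pseudoreflectionSubgroup ((pseudoreflectionSubgroup G).map G.subtype) = ⊤ := by
  set H' := (pseudoreflectionSubgroup G).map G.subtype
  let i : H' →* G := Subgroup.inclusion (Subgroup.map_subtype_le _)
  have hle : pseudoreflectionSubgroup G ≤ (pseudoreflectionSubgroup H').map i :=
    (Subgroup.closure_le _).2 fun g hg =>
      ⟨⟨g, g, Subgroup.subset_closure hg, rfl⟩, Subgroup.subset_closure hg, rfl⟩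
  refine eq_top_iff.2 fun h _ => ?_
  obtain ⟨g, hg, hgh⟩ := h.2
  obtain ⟨h', hh', hi⟩ := hle hg
  have : h' = h := Subtype.ext ((congrArg Subtype.val hi).trans hgh)
  exact this ▸ hh'

end Stabilizers

/-! ### Isolated singularities and invariants of stabilizers -/

section IsolatedSingularities

variable {k : Type u} [Field k] [IsAlgClosed k] {V : Type v} [AddCommGroup V] [Module k V]
  [FiniteDimensional k V] {G : Subgroup (V ≃ₗ[k] V)} [Finite G]

/-- If `V/G` is regular at the image of a vector, then the invariants of its stabilizer form a
polynomial ring. -/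
theorem isPolynomialRing_stabilizer {w : V}
    (h : Module.finrank k (RingHom.ker (evalOn (Invariants k V G) w)).Cotangent =
      Module.finrank k V) :
    IsPolynomialRing k (Invariants k V (MulAction.stabilizer G w)) := by
  rw [finrank_cotangent_stabilizer_eq, finrank_cotangent_translate fun _ hg => hg] at h
  exact isPolynomialRing_of_finrank_cotangent (isGradedSubalgebra_invariants _) h

/-- The invariants of the pointwise stabilizers of the nonzero subspaces are polynomial rings if
`V/G` has at most an isolated singularity at the origin. -/
theorem IsIsolatedQuotientSingularity.isPolynomialRing_fixingSubgroup
    (h : IsIsolatedQuotientSingularity G) {W : Submodule k V} (hW : W ≠ ⊥) :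
    IsPolynomialRing k (Invariants k V (fixingSubgroup G (W : Set V))) := by
  obtain ⟨-, U, hU, hreg⟩ := h
  rw [quotientProj_origin] at hU hreg
  obtain ⟨_, ⟨f, rfl⟩, hf₀, hfU⟩ :=
    PrimeSpectrum.isTopologicalBasis_basic_opens.exists_subset_of_mem_open hU U.isOpen
  have : Infinite k := IsAlgClosed.instInfinite
  -- The invariant `f` cuts out a basic neighbourhood of the origin inside `U`, so the generic `w`
  -- can be taken over the regular locus.
  obtain ⟨w, hwW, hw₀, hstab, hfw⟩ := exists_stabilizer_eq_fixingSubgroup (G := G) hW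
    (f := (f : CoordRing k V)) hf₀
  have hne : quotientPoint k G w ≠ quotientPoint k G 0 := by
    intro heq
    obtain ⟨g, hg⟩ := exists_smul_eq_of_ker_evalOn_eq (Γ := G) evalAt_smul_subgroup
      (congrArg PrimeSpectrum.asIdeal heq)
    exact hw₀ ((smul_eq_zero_iff_eq g).1 hg)
  have hr := (isRegularPoint_quotientPoint_iff w).1
    (hreg _ (hfU hfw) (isClosed_quotientPoint w) hne)
  rw [← hstab]
  exact isPolynomialRing_stabilizer hr

/-- If the invariants of all stabilizers of nonzero vectors are polynomial rings, then `V/G` is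
regular outside of the origin. -/
theorem isIsolatedQuotientSingularity_of_not_isPolynomialRing
    (hG : ¬ IsPolynomialRing k (Invariants k V G))
    (h : ∀ W : Submodule k V, W ≠ ⊥ →
      IsPolynomialRing k (Invariants k V (fixingSubgroup G (W : Set V)))) :
    IsIsolatedQuotientSingularity G := by
  refine ⟨?_, ⊤, trivial, fun x _ hx hne => ?_⟩
  · rw [quotientProj_origin, isRegularPoint_quotientPoint_iff]
    exact fun hr => hG (isPolynomialRing_of_finrank_cotangent isGradedSubalgebra_invariants' hr)
  · rw [quotientProj_origin] at hne
    obtain ⟨w, rfl⟩ := exists_eq_quotientPoint x hx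
    have hw : w ≠ 0 := fun h => hne (by rw [h])
    rw [isRegularPoint_quotientPoint_iff, finrank_cotangent_stabilizer_eq,
      ← fixingSubgroup_span_singleton]
    exact (h _ (mt Submodule.span_singleton_eq_bot.1 hw)).finrank_cotangent w

end IsolatedSingularities

section IsolatedSingularityStructure

variable {k : Type u} [Field k] [IsAlgClosed k] {V : Type v} [AddCommGroup V] [Module k V]
  [FiniteDimensional k V] {G : Subgroup (V ≃ₗ[k] V)} [Finite G]

instance (H : Subgroup G) : Finite (H.map G.subtype) :=
  (((H : Set G).toFinite).image G.subtype).to_subtype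

/-- Pointwise stabilizers of nonzero subspaces inherit polynomial rings of invariants. -/
theorem IsPolynomialRing.fixingSubgroup (h : IsPolynomialRing k (Invariants k V G))
    {W : Submodule k V} (hW : W ≠ ⊥) :
    IsPolynomialRing k (Invariants k V (fixingSubgroup G (W : Set V))) := by
  have : Infinite k := IsAlgClosed.instInfinite
  obtain ⟨w, -, -, hstab, -⟩ := exists_stabilizer_eq_fixingSubgroup (G := G) hW (f := 1)
    (by rw [map_one]; exact one_ne_zero)
  rw [← hstab]
  exact isPolynomialRing_stabilizer (h.finrank_cotangent w)

/-- By Serre's theorem the pointwise stabilizer is generated by its own pseudoreflections, which are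
pseudoreflections of `G`. -/
theorem IsIsolatedQuotientSingularity.fixingSubgroup_le (h : IsIsolatedQuotientSingularity G)
    {W : Submodule k V} (hW : W ≠ ⊥) :
    _root_.fixingSubgroup G (W : Set V) ≤ pseudoreflectionSubgroup G := by
  have hpoly := h.isPolynomialRing_fixingSubgroup hW
  rw [← invariants_map_subtype] at hpoly
  exact le_pseudoreflectionSubgroup (pseudoreflectionSubgroup_eq_top hpoly)

theorem IsIsolatedQuotientSingularity.invariants_fixingSubgroup
    (h : IsIsolatedQuotientSingularity G) {W : Submodule k V} (hW : W ≠ ⊥) :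
    Invariants k V (_root_.fixingSubgroup ((pseudoreflectionSubgroup G).map G.subtype)
      (W : Set V)) = Invariants k V (_root_.fixingSubgroup G (W : Set V)) := by
  ext f
  constructor
  · intro hf g
    exact hf ⟨⟨g, g, h.fixingSubgroup_le hW g.2, rfl⟩, g.2⟩
  · rintro hf ⟨⟨_, g, hg, rfl⟩, hgW⟩
    exact hf ⟨g, hgW⟩

end IsolatedSingularityStructure

end QuotientSingularity

end

/-! ### The equivalence -/

theorem mainTheorem3 (k : Type u) [Field k] [IsAlgClosed k] (p : ℕ) [CharP k p] :
    (∀ (V : Type v) [AddCommGroup V] [Module k V] [FiniteDimensional k V]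
        (G : Subgroup (V ≃ₗ[k] V)) [Finite G],
      QuotientSingularity.IsPolynomialRing k (QuotientSingularity.Invariants k V G) ↔
        QuotientSingularity.pseudoreflectionSubgroup G = ⊤ ∧
        ∀ W : Submodule k V, W ≠ ⊥ →
          QuotientSingularity.IsPolynomialRing k
            (QuotientSingularity.Invariants k V (fixingSubgroup G (W : Set V)))) ↔
    (∀ (V : Type v) [AddCommGroup V] [Module k V] [FiniteDimensional k V]
        (G : Subgroup (V ≃ₗ[k] V)) [Finite G],
      QuotientSingularity.IsIsolatedQuotientSingularity G →
        QuotientSingularity.IsNonsingular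
          (QuotientSingularity.quotientVariety k V
            (QuotientSingularity.pseudoreflectionSubgroup G)) ∧
        ¬ p ∣ Nat.card (G ⧸ QuotientSingularity.pseudoreflectionSubgroup G) ∧
        ∃ e : QuotientSingularity.quotientVariety k V G ≅
            QuotientSingularity.iteratedQuotient G
              (QuotientSingularity.pseudoreflectionSubgroup G),
          QuotientSingularity.quotientProj k V G ≫ e.hom =
            QuotientSingularity.quotientProj k V
                (QuotientSingularity.pseudoreflectionSubgroup G) ≫
              QuotientSingularity.iteratedQuotientProj G
                (QuotientSingularity.pseudoreflectionSubgroup G)) := by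
  open QuotientSingularity in
  constructor
  · intro h V _ _ _ G _ hG
    have hpoly : IsPolynomialRing k (Invariants k V (pseudoreflectionSubgroup G)) := by
      rw [← invariants_map_subtype, h]
      refine ⟨pseudoreflectionSubgroup_map_pseudoreflectionSubgroup G, fun W hW => ?_⟩
      rw [hG.invariants_fixingSubgroup hW]
      exact hG.isPolynomialRing_fixingSubgroup hW
    have := hpoly.isRegularRing
    refine ⟨isNonsingular_Spec, not_dvd_card_quotient p _ (fun g v hv hg => ?_)
      (hpoly.finrank_cotangent 0), exists_iso_iteratedQuotient G _⟩
    refine hG.fixingSubgroup_le (mt Submodule.span_singleton_eq_bot.1 hv) ?_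
    rw [fixingSubgroup_span_singleton]
    exact hg
  · intro h V _ _ _ G _
    refine ⟨fun hG => ⟨pseudoreflectionSubgroup_eq_top hG, fun W hW => hG.fixingSubgroup hW⟩, ?_⟩
    rintro ⟨htop, hW⟩
    by_contra hG
    refine hG ?_
    -- Only nonsingularity of `V/H` at the image of the origin is used; since `H = G`, it already
    -- makes the invariants of `G` polynomial.
    have hreg := (h V G (isIsolatedQuotientSingularity_of_not_isPolynomialRing hG hW)).1
      (quotientPoint k _ 0)
    rw [isRegularPoint_quotientPoint_iff] at hreg
    have hpoly := isPolynomialRing_of_finrank_cotangent (isGradedSubalgebra_invariants _) hreg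
    rw [← invariants_map_subtype, htop, ← MonoidHom.range_eq_map, Subgroup.range_subtype] at hpoly
    exact hpoly
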